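/- Let $G$ be a connected semisimple complex algebraic group of adjoint type, with Lie algebra $\mathfrak g$; through the adjoint representation, $G$ is identified with the group of automorphisms of $\mathfrak g$ generated by the $\exp(\operatorname{ad}x)$ with $\operatorname{ad}x$ nilpotent. Let $T\subset G$ be a maximal torus with Lie algebra $\mathfrak t$, $\Phi$ the roots, $\Phi^+$ the positive roots of a chosen base, $\alpha_i$ a simple root, $s_i$ its reflection, $W=N_G(T)/T$ the Weyl group and $W_{P_i}=\{1,s_i\}$. Put $$\mathfrak p_i=\mathfrak t\oplus\bigoplus_{\beta\in\Phi^+}\mathfrak g_\beta\oplus\mathfrak g_{-\alpha_i},\qquad \mathfrak p_i^-=\mathfrak t\oplus\bigoplus_{\beta\in\Phi^+}\mathfrak g_{-\beta}\oplus\mathfrak g_{\alpha_i},\qquad \mathfrak l_i=\mathfrak t\oplus\mathfrak g_{\alpha_i}\oplus\mathfrak g_{-\alpha_i},$$ let $\mathfrak u_i=\bigoplus_{\beta\in\Phi^+\setminus\{\alpha_i\}}\mathfrak g_\beta$ and $\mathfrak u_i^-=\bigoplus_{\beta\in\Phi^+\setminus\{\alpha_i\}}\mathfrak g_{-\beta}$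 be the nilradicals, so that there are projections $\mathfrak p_i\to\mathfrak p_i/\mathfrak u_i=\mathfrak l_i\to\mathfrak l_i/Z(\mathfrak l_i)$ and $\mathfrak p_i^-\to\mathfrak p_i^- /\mathfrak u_i^-=\mathfrak l_i\to\mathfrak l_i/Z(\mathfrak l_i)$. Let $\mathfrak b$ and $\mathfrak b^-$ be the images of $\mathfrak t\oplus\mathfrak g_{\alpha_i}$ and $\mathfrak t\oplus\mathfrak g_{-\alpha_i}$ in $\mathfrak l_i/Z(\mathfrak l_i)$. For a representative $\dot w\in N_G(T)$ of $w\in W$ let $$\mathfrak g_{\dot w}=\{(x,\operatorname{Ad}(\dot w)x):x\in\mathfrak g\}\subset\mathfrak g\oplus\mathfrak g$$ be the Lie algebra of $(1,\dot w)G_\Delta(1,\dot w^{-1})$, where $G_\Delta\subset G\times G$ is the diagonal. Then there is an isomorphism of Lie algebras $\mathfrak l_i/Z(\mathfrak l_i)\cong\mathfrak{sl}_2(\mathbb C)$ that carries $\mathfrak b$ and $\mathfrak b^-$ to the upper and the lower triangular matrices. Let $w\in W$ be of minimal length in its double coset $W_{P_i}wW_{P_i}$. Then $w$ has representatives $\dot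 w\in N_G(T)$, and for every representative $\dot w$ the image of $\mathfrak g_{\dot w}\cap(\mathfrak p_i\oplus\mathfrak p_i^-)$ in $\mathfrak l_i/Z(\mathfrak l_i)\oplus\mathfrak l_i/Z(\mathfrak l_i)\cong\mathfrak{sl}_2\oplus\mathfrak{sl}_2$ is as follows. 1. If $w(\alpha_i)=\alpha_i$, the image is the diagonal if and only if $\operatorname{Ad}(\dot w)$ is the identity on $\mathfrak g_{\alpha_i}$; and for every representative $\dot w$ there is $t\in T$ such that the image for the representative $t\dot w$ of $w$ is the diagonal. 2. If $w(\alpha_i)\neq\alpha_i$, the image is the Borel subalgebra $\mathfrak b^-\oplus\mathfrak b$. -/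

import Mathlib

open LieAlgebra LieAlgebra.IsKilling RootPairing

noncomputable section

namespace DiagOrbit

variable {𝔤 : Type*} [LieRing 𝔤] [LieAlgebra ℂ 𝔤]

/-- The linear endomorphism `exp (ad x) = ∑ (ad x)^k / k!` for `ad x` nilpotent. -/
def expAd (x : 𝔤) : Module.End ℂ 𝔤 :=
  ∑ k ∈ Finset.range (nilpotencyClass (ad ℂ 𝔤 x)), ((k.factorial : ℂ)⁻¹) • (ad ℂ 𝔤 x) ^ k

variable (𝔤) in
/-- The adjoint group of `𝔤`: the group of linear automorphisms generated by the `exp (ad x)` with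
`ad x` nilpotent. For `𝔤` complex semisimple this is the identity component of `Aut 𝔤`, i.e. (through
its faithful adjoint representation) the connected semisimple group of adjoint type with Lie
algebra `𝔤`. The adjoint action of an element is its evaluation on `𝔤`. -/
def adjointGroup : Subgroup (𝔤 ≃ₗ[ℂ] 𝔤) :=
  Subgroup.closure {g | ∃ x : 𝔤, IsNilpotent (ad ℂ 𝔤 x) ∧ (g : 𝔤 →ₗ[ℂ] 𝔤) = expAd x}

/-- The maximal torus of the adjoint group with Lie algebra the Cartan subalgebra `H`: the elements
that centralize `H`. -/
def torus (H : LieSubalgebra ℂ 𝔤) : Subgroup (𝔤 ≃ₗ[ℂ] 𝔤) :=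
  adjointGroup 𝔤 ⊓
    { carrier := {g | ∀ h ∈ H, g h = h}
      mul_mem' := fun {a c} ha hc h hh => by
        rw [LinearEquiv.mul_apply, hc h hh, ha h hh]
      one_mem' := fun _ _ => rfl
      inv_mem' := fun {a} ha h hh => by
        have := congrArg a.symm (ha h hh)
        rw [a.symm_apply_apply] at this
        exact this.symm }

variable [FiniteDimensional ℂ 𝔤] [LieAlgebra.IsSemisimple ℂ 𝔤]
variable {H : LieSubalgebra ℂ 𝔤} [H.IsCartanSubalgebra]

/-! ### The Weyl group -/

/-- `n` is a representative in the adjoint group (in the normalizer of the torus) of the Weyl group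
element `w`: it preserves `H` and its action on `H` is dual to the action of `w` on the roots,
`(w α) (n h) = α h`. -/
def IsLift (w : (rootSystem H).weylGroup) (n : 𝔤 ≃ₗ[ℂ] 𝔤) : Prop :=
  n ∈ adjointGroup 𝔤 ∧
    ∀ h : H, ∃ h' : H, n (h : 𝔤) = h' ∧ ∀ α : H.root, (w • α).1 h' = α.1 h

/-- The length of `w` with respect to the simple reflections: the least length of a word in the
simple reflections with product `w`. -/
def weylLength (b : (rootSystem H).Base) (w : (rootSystem H).weylGroup) : ℕ :=
  sInf {m | ∃ l : List H.root, (∀ j ∈ l, j ∈ b.support) ∧ l.length = m ∧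
    (l.map (weylGroup.ofIdx (rootSystem H))).prod = w}

/-- The parabolic subgroup `W_{P_i} = ⟨s_i⟩` of the Weyl group. -/
def weylParabolic (i : H.root) : Subgroup (rootSystem H).weylGroup :=
  Subgroup.closure {weylGroup.ofIdx (rootSystem H) i}

/-- `w` is a representative of minimal length of its double coset `W_{P_i} w W_{P_i}`. -/
def IsMinimalRep (b : (rootSystem H).Base) (i : H.root) (w : (rootSystem H).weylGroup) : Prop :=
  ∀ v ∈ DoubleCoset.doubleCoset w (weylParabolic i : Set (rootSystem H).weylGroup)
    (weylParabolic i : Set (rootSystem H).weylGroup), weylLength b w ≤ weylLength b v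

/-! ### Parabolic and Levi subalgebras -/

/-- The root space `𝔤_α`. -/
def rootSub (α : H.root) : Submodule ℂ 𝔤 := (rootSpace H (α.1 : H → ℂ)).toSubmodule

/-- The root space `𝔤_{-α}`. -/
def negRootSub (α : H.root) : Submodule ℂ 𝔤 := (rootSpace H (-(α.1 : H → ℂ))).toSubmodule

/-- `𝔭_i = 𝔱 ⊕ ⨁_{β > 0} 𝔤_β ⊕ 𝔤_{-α_i}`. -/
def parabolic (b : (rootSystem H).Base) (i : H.root) : Submodule ℂ 𝔤 :=
  H.toSubmodule ⊔ (⨆ β : H.root, ⨆ _ : b.IsPos β, rootSub β) ⊔ negRootSub i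

/-- `𝔭_i⁻ = 𝔱 ⊕ ⨁_{β > 0} 𝔤_{-β} ⊕ 𝔤_{α_i}`. -/
def oppParabolic (b : (rootSystem H).Base) (i : H.root) : Submodule ℂ 𝔤 :=
  H.toSubmodule ⊔ (⨆ β : H.root, ⨆ _ : b.IsPos β, negRootSub β) ⊔ rootSub i

/-- The nilradical `𝔲_i = ⨁_{β > 0, β ≠ α_i} 𝔤_β` of `𝔭_i`. -/
def nilrad (b : (rootSystem H).Base) (i : H.root) : Submodule ℂ 𝔤 :=
  ⨆ β : H.root, ⨆ _ : b.IsPos β ∧ β ≠ i, rootSub β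

/-- The nilradical `𝔲_i⁻ = ⨁_{β > 0, β ≠ α_i} 𝔤_{-β}` of `𝔭_i⁻`. -/
def oppNilrad (b : (rootSystem H).Base) (i : H.root) : Submodule ℂ 𝔤 :=
  ⨆ β : H.root, ⨆ _ : b.IsPos β ∧ β ≠ i, negRootSub β

theorem lie_mem_levi (i : H.root) {x y : 𝔤}
    (hx : x ∈ H.toSubmodule ⊔ rootSub i ⊔ negRootSub i)
    (hy : y ∈ H.toSubmodule ⊔ rootSub i ⊔ negRootSub i) :
    ⁅x, y⁆ ∈ H.toSubmodule ⊔ rootSub i ⊔ negRootSub i := by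
  have hi : i.1.IsNonZero := LieSubalgebra.isNonZero_coe_root i
  have h0 : ∀ z : 𝔤, z ∈ H ↔ z ∈ rootSpace H (0 : H → ℂ) := fun z => by
    rw [← LieSubalgebra.mem_toLieSubmodule, ← rootSpace_zero_eq ℂ 𝔤 H]
  have hl : ∀ {χ₁ χ₂ : H → ℂ} {a c : 𝔤}, a ∈ rootSpace H χ₁ → c ∈ rootSpace H χ₂ →
      ⁅a, c⁆ ∈ rootSpace H (χ₁ + χ₂) := fun ha hc =>
    lie_mem_genWeightSpace_of_mem_genWeightSpace ha hc
  have h2 : rootSpace H ((i.1 : H → ℂ) + i.1) = ⊥ := by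
    rw [← two_smul ℕ]; exact rootSpace_two_smul i.1 hi
  have h2' : rootSpace H (-(i.1 : H → ℂ) + -i.1) = ⊥ := by
    have := rootSpace_two_smul (-i.1) (by simpa using hi)
    rwa [two_smul, LieModule.Weight.coe_neg] at this
  obtain ⟨x', hx', x₂, hx₂, rfl⟩ := Submodule.mem_sup.1 hx
  obtain ⟨x₀, hx₀, x₁, hx₁, rfl⟩ := Submodule.mem_sup.1 hx'
  obtain ⟨y', hy', y₂, hy₂, rfl⟩ := Submodule.mem_sup.1 hy
  obtain ⟨y₀, hy₀, y₁, hy₁, rfl⟩ := Submodule.mem_sup.1 hy'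
  replace hx₀ := (h0 _).1 hx₀
  replace hy₀ := (h0 _).1 hy₀
  have A : ∀ z, z ∈ rootSpace H (0 : H → ℂ) → z ∈ H.toSubmodule ⊔ rootSub i ⊔ negRootSub i :=
    fun z hz => Submodule.mem_sup_left (Submodule.mem_sup_left ((h0 z).2 hz))
  have B : ∀ z, z ∈ rootSpace H (i.1 : H → ℂ) → z ∈ H.toSubmodule ⊔ rootSub i ⊔ negRootSub i :=
    fun z hz => Submodule.mem_sup_left (Submodule.mem_sup_right hz)
  have C : ∀ z, z ∈ rootSpace H (-(i.1 : H → ℂ)) →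
      z ∈ H.toSubmodule ⊔ rootSub i ⊔ negRootSub i :=
    fun z hz => Submodule.mem_sup_right hz
  have e11 : ⁅x₁, y₁⁆ = 0 := by simpa [h2] using hl hx₁ hy₁
  have e22 : ⁅x₂, y₂⁆ = 0 := by simpa [h2'] using hl hx₂ hy₂
  have m00 := A _ (by simpa using hl hx₀ hy₀)
  have m01 := B _ (by simpa using hl hx₀ hy₁)
  have m02 := C _ (by simpa using hl hx₀ hy₂)
  have m10 := B _ (by simpa using hl hx₁ hy₀)
  have m12 := A _ (by simpa using hl hx₁ hy₂)
  have m20 := C _ (by simpa using hl hx₂ hy₀)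
  have m21 := A _ (by simpa using hl hx₂ hy₁)
  simp only [add_lie, lie_add, e11, e22, add_zero]
  repeat' apply add_mem
  all_goals assumption

/-- The Levi subalgebra `𝔩_i = 𝔱 ⊕ 𝔤_{α_i} ⊕ 𝔤_{-α_i}` of `𝔭_i`. -/
def levi (i : H.root) : LieSubalgebra ℂ 𝔤 where
  toSubmodule := H.toSubmodule ⊔ rootSub i ⊔ negRootSub i
  lie_mem' := lie_mem_levi i

/-- The quotient `𝔩_i / Z(𝔩_i)`. -/
abbrev LeviQuot (i : H.root) : Type _ := levi i ⧸ LieAlgebra.center ℂ (levi i)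

/-- The quotient map `𝔩_i → 𝔩_i / Z(𝔩_i)`. -/
def leviMk (i : H.root) : levi i →ₗ[ℂ] LeviQuot i :=
  (LieSubmodule.Quotient.mk' (LieAlgebra.center ℂ (levi i)) : levi i →ₗ[ℂ] LeviQuot i)

/-- The Borel subalgebra `𝔟` of `𝔩_i / Z(𝔩_i)`: the image of `𝔱 ⊕ 𝔤_{α_i}`. -/
def borel (i : H.root) : Submodule ℂ (LeviQuot i) :=
  ((H.toSubmodule ⊔ rootSub i).comap (levi i).toSubmodule.subtype).map (leviMk i)

/-- The opposite Borel subalgebra `𝔟⁻` of `𝔩_i / Z(𝔩_i)`: the image of `𝔱 ⊕ 𝔤_{-α_i}`. -/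
def oppBorel (i : H.root) : Submodule ℂ (LeviQuot i) :=
  ((H.toSubmodule ⊔ negRootSub i).comap (levi i).toSubmodule.subtype).map (leviMk i)

/-- The diagonal in `V ⊕ V`. -/
def diagonal (V : Type*) [AddCommGroup V] [Module ℂ V] : Submodule ℂ (V × V) :=
  LinearMap.range (LinearMap.id.prod LinearMap.id)

/-! ### The image of `𝔤_w ∩ (𝔭_i ⊕ 𝔭_i⁻)` -/

/-- The Lie algebra `{(x, Ad(n) x)}` of the subgroup `(1, n) G_Δ (1, n⁻¹)` of `G × G`. -/
def twistedDiagonal (n : 𝔤 ≃ₗ[ℂ] 𝔤) : Submodule ℂ (𝔤 × 𝔤) :=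
  LinearMap.range (LinearMap.id.prod (n : 𝔤 →ₗ[ℂ] 𝔤))

/-- `𝔤_w ∩ (𝔭_i ⊕ 𝔭_i⁻)`, for the representative `n` of `w`. -/
def intersection (b : (rootSystem H).Base) (i : H.root) (n : 𝔤 ≃ₗ[ℂ] 𝔤) : Submodule ℂ (𝔤 × 𝔤) :=
  twistedDiagonal n ⊓ (parabolic b i).prod (oppParabolic b i)

/-- The image of `𝔤_w ∩ (𝔭_i ⊕ 𝔭_i⁻)` in `𝔩_i/Z(𝔩_i) ⊕ 𝔩_i/Z(𝔩_i)` under the projections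
`𝔭_i → 𝔭_i / 𝔲_i = 𝔩_i → 𝔩_i/Z(𝔩_i)` and `𝔭_i⁻ → 𝔭_i⁻ / 𝔲_i⁻ = 𝔩_i → 𝔩_i/Z(𝔩_i)`: an element `(x, y)`
with `x = x₀ + u`, `y = y₀ + v`, `x₀, y₀ ∈ 𝔩_i`, `u ∈ 𝔲_i`, `v ∈ 𝔲_i⁻` goes to the class of
`(x₀, y₀)`. -/
def image (b : (rootSystem H).Base) (i : H.root) (n : 𝔤 ≃ₗ[ℂ] 𝔤) :
    Submodule ℂ (LeviQuot i × LeviQuot i) :=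
  ((intersection b i n ⊔ (nilrad b i).prod (oppNilrad b i)).comap
    ((levi i).toSubmodule.subtype.prodMap (levi i).toSubmodule.subtype)).map
    ((leviMk i).prodMap (leviMk i))

/-- The upper triangular matrices in `𝔰𝔩₂`. -/
def upperSl2 : Submodule ℂ (SpecialLinear.sl (Fin 2) ℂ) where
  carrier := {A | A.1 1 0 = 0}
  add_mem' := fun {A B} hA hB => by simp_all
  zero_mem' := rfl
  smul_mem' := fun c A hA => by simp_all

/-- The lower triangular matrices in `𝔰𝔩₂`. -/
def lowerSl2 : Submodule ℂ (SpecialLinear.sl (Fin 2) ℂ) where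
  carrier := {A | A.1 0 1 = 0}
  add_mem' := fun {A B} hA hB => by simp_all
  zero_mem' := rfl
  smul_mem' := fun c A hA => by simp_all

end DiagOrbit

end

/-! Minimality of `w` enters through two positivity facts: if `w α_i` were negative, the exchange
condition would make `w s_i` shorter, and similarly `s_i w` if `w⁻¹ α_i` were negative. So `w α_i`
and `w⁻¹ α_i` are positive roots.

The quotient `𝔩_i / Z(𝔩_i)` is read off with the Killing form κ. For a triple `h, e, f` on the root
spaces of `±α_i`, the numbers κ(x,h)/2, κ(x,f), κ(x,e), divided by κ(e,f), are the matrix entries of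
`x` (`slCoord`). They are defined on all of `𝔤` and vanish on both nilradicals, so the image is the
set of pairs of coordinates of `x` and `n x`, for `x` in `𝔭_i` with `n x` in `𝔭_i⁻`
(`mem_image_iff`). Since `n` preserves κ, coordinates of `n x` can be traded for pairings with `x`,
and conversely.

If `w α_i = α_i`, then `n e = c e`. When `c = 1` the whole triple is fixed and `x`, `n x` have equal
coordinates; otherwise the pair from `e` itself leaves the diagonal. The torus scales `e` by any
nonzero number, so `c` can be corrected to 1.

If `w α_i ≠ α_i`, then κ(x,f) = κ(n x, n f) = 0, because `n f` has root `-w α_i` and is orthogonal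
to `𝔭_i⁻`; likewise κ(n x, e) = κ(x, n⁻¹ e) = 0. This bounds the image by `𝔟⁻ ⊕ 𝔟`. All of it is
reached because the distinct positive roots `α_i` and `w⁻¹ α_i` are linearly independent. -/

noncomputable section

/-! ### Words in simple reflections -/

namespace RootPairing

variable {ι R M N : Type*} [CommRing R] [AddCommGroup M] [Module R M] [AddCommGroup N] [Module R N]
  {P : RootPairing ι R M N}

theorem weylGroup.ofIdx_smul_index (i j : ι) :
    weylGroup.ofIdx P i • j = P.reflectionPerm i j := rfl

theorem weylGroup.ofIdx_mul_self (i : ι) : weylGroup.ofIdx P i * weylGroup.ofIdx P i = 1 :=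
  Subtype.ext <| by
    change Equiv.reflection P i * Equiv.reflection P i = 1
    rw [mul_eq_one_iff_inv_eq, Equiv.reflection_inv P i]

theorem weylGroup.ofIdx_inv (i : ι) : (weylGroup.ofIdx P i)⁻¹ = weylGroup.ofIdx P i :=
  inv_eq_of_mul_eq_one_left (weylGroup.ofIdx_mul_self i)

theorem weylGroup.ofIdx_reflectionPerm (i j : ι) :
    weylGroup.ofIdx P (P.reflectionPerm j i) =
      weylGroup.ofIdx P j * weylGroup.ofIdx P i * weylGroup.ofIdx P j := by
  apply Subtype.ext
  apply Equiv.weightHom_injective P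
  change Equiv.weightHom P (Equiv.reflection P _) =
    Equiv.weightHom P (Equiv.reflection P j * Equiv.reflection P i * Equiv.reflection P j)
  simp only [map_mul, Equiv.weightHom_apply, Equiv.reflection_weightEquiv]
  exact P.reflection_reflectionPerm

theorem weylGroup.ofIdx_smul_eq_conj (w : P.weylGroup) (i : ι) :
    weylGroup.ofIdx P (w • i) = w * weylGroup.ofIdx P i * w⁻¹ := by
  obtain ⟨g, hg⟩ := w
  induction hg using weylGroup.induction generalizing i with
  | mem j =>
    change weylGroup.ofIdx P (weylGroup.ofIdx P j • i) =
      weylGroup.ofIdx P j * weylGroup.ofIdx P i * (weylGroup.ofIdx P j)⁻¹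
    rw [weylGroup.ofIdx_smul_index, weylGroup.ofIdx_inv, weylGroup.ofIdx_reflectionPerm]
  | one =>
    change weylGroup.ofIdx P ((1 : P.weylGroup) • i) =
      (1 : P.weylGroup) * weylGroup.ofIdx P i * (1 : P.weylGroup)⁻¹
    simp
  | mul x y hx hy h₁ h₂ =>
    change weylGroup.ofIdx P (((⟨x, hx⟩ : P.weylGroup) * ⟨y, hy⟩) • i) =
      ((⟨x, hx⟩ : P.weylGroup) * ⟨y, hy⟩) * weylGroup.ofIdx P i *
        ((⟨x, hx⟩ : P.weylGroup) * ⟨y, hy⟩)⁻¹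
    rw [mul_smul, h₁, h₂]
    group

namespace Base

variable [CharZero R] [Finite ι] [IsDomain R] [P.IsCrystallographic] [P.IsReduced] (b : P.Base)

/-- The Weyl group is generated by the simple reflections. -/
theorem closure_ofIdx_support :
    Subgroup.closure (Set.image (weylGroup.ofIdx P) b.support) = ⊤ := by
  have key (i : ι) :
      weylGroup.ofIdx P i ∈ Subgroup.closure (Set.image (weylGroup.ofIdx P) b.support) := by
    refine b.induction_reflect i (fun i hi => ?_)
      (fun i hi => Subgroup.subset_closure (Set.mem_image_of_mem _ hi)) fun i j hi hj => ?_
    · rwa [weylGroup.ofIdx_reflectionPerm, weylGroup.ofIdx_mul_self, one_mul]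
    · have := Subgroup.subset_closure (Set.mem_image_of_mem (weylGroup.ofIdx P) hj)
      rw [weylGroup.ofIdx_reflectionPerm]
      exact mul_mem (mul_mem this hi) this
  rw [eq_top_iff]
  rintro ⟨g, hg⟩ -
  induction hg using weylGroup.induction with
  | mem j => exact key j
  | one => exact one_mem _
  | mul x y hx hy h₁ h₂ => exact mul_mem h₁ h₂

theorem exists_list_prod_ofIdx_eq (w : P.weylGroup) :
    ∃ l : List ι, (∀ j ∈ l, j ∈ b.support) ∧ (l.map (weylGroup.ofIdx P)).prod = w := by
  have hw : w ∈ Subgroup.closure (Set.image (weylGroup.ofIdx P) b.support) := by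
    rw [b.closure_ofIdx_support]; trivial
  induction hw using Subgroup.closure_induction with
  | mem x hx =>
    obtain ⟨j, hj, rfl⟩ := hx
    exact ⟨[j], by simpa using hj, by simp⟩
  | one => exact ⟨[], by simp, by simp⟩
  | mul x y _ _ hx hy =>
    obtain ⟨l, hl, rfl⟩ := hx
    obtain ⟨m, hm, rfl⟩ := hy
    refine ⟨l ++ m, fun j hj => ?_, by simp⟩
    rcases List.mem_append.1 hj with h | h
    exacts [hl j h, hm j h]
  | inv x _ hx =>
    obtain ⟨l, hl, rfl⟩ := hx
    refine ⟨l.reverse, by simpa using hl, ?_⟩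
    rw [List.prod_inv_reverse, List.map_map, List.map_reverse]
    congr 2
    exact List.map_congr_left fun j _ => (weylGroup.ofIdx_inv j).symm

variable {b}

/-- The exchange condition. -/
theorem exists_list_prod_eq_mul_ofIdx {i : ι} (hi : i ∈ b.support) (l : List ι)
    (hl : ∀ j ∈ l, j ∈ b.support) (h : ¬ b.IsPos ((l.map (weylGroup.ofIdx P)).prod • i)) :
    ∃ m : List ι, (∀ j ∈ m, j ∈ b.support) ∧ m.length + 1 = l.length ∧
      (m.map (weylGroup.ofIdx P)).prod = (l.map (weylGroup.ofIdx P)).prod * weylGroup.ofIdx P i := by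
  induction l with
  | nil => exact absurd (isPos_of_mem_support hi) (by simpa using h)
  | cons j t ih =>
    have hj : j ∈ b.support := hl j (by simp)
    have ht : ∀ k ∈ t, k ∈ b.support := fun k hk => hl k (by simp [hk])
    rw [List.map_cons, List.prod_cons] at h ⊢
    set v := (t.map (weylGroup.ofIdx P)).prod with hv
    by_cases hp : b.IsPos (v • i)
    -- Here `s_j` makes the positive root `v i` negative, and `j` is the only positive root with
    -- that property. Hence `s_j = v s_i v⁻¹`, and the letter to delete is `j`; in the other case it
    -- lies further right.
    · have hvj : v • i = j := by
        by_contra hne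
        exact h (by rw [mul_smul]; exact hp.reflectionPerm hj hne)
      refine ⟨t, ht, by simp, ?_⟩
      rw [← hvj, weylGroup.ofIdx_smul_eq_conj, inv_mul_cancel_right, mul_assoc,
        weylGroup.ofIdx_mul_self, mul_one]
    · obtain ⟨m, hm, hlen, hprod⟩ := ih ht hp
      refine ⟨j :: m, by simpa using ⟨hj, hm⟩, by simp [hlen], ?_⟩
      rw [List.map_cons, List.prod_cons, hprod, mul_assoc]

end Base

end RootPairing

/-! ### Length and minimal double coset representatives. -/

namespace DiagOrbit

variable {𝔤 : Type*} [LieRing 𝔤] [LieAlgebra ℂ 𝔤] [FiniteDimensional ℂ 𝔤]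
  [LieAlgebra.IsSemisimple ℂ 𝔤] {H : LieSubalgebra ℂ 𝔤} [H.IsCartanSubalgebra]

theorem weylLength_le (b : (rootSystem H).Base) (l : List H.root) (hl : ∀ j ∈ l, j ∈ b.support) :
    weylLength b (l.map (weylGroup.ofIdx (rootSystem H))).prod ≤ l.length :=
  Nat.sInf_le ⟨l, hl, rfl, rfl⟩

/-- Simple reflections generate the Weyl group, so the infimum is over a nonempty set and is
attained, instead of being the default value 0. -/
theorem exists_list_length_eq_weylLength (b : (rootSystem H).Base)
    (w : (rootSystem H).weylGroup) :
    ∃ l : List H.root, (∀ j ∈ l, j ∈ b.support) ∧ l.length = weylLength b w ∧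
      (l.map (weylGroup.ofIdx (rootSystem H))).prod = w := by
  obtain ⟨l, hl, hw⟩ := b.exists_list_prod_ofIdx_eq w
  exact Nat.sInf_mem (s := {m | ∃ l : List H.root, (∀ j ∈ l, j ∈ b.support) ∧ l.length = m ∧
    (l.map (weylGroup.ofIdx (rootSystem H))).prod = w}) ⟨_, l, hl, rfl, hw⟩

theorem weylLength_inv (b : (rootSystem H).Base) (w : (rootSystem H).weylGroup) :
    weylLength b w⁻¹ = weylLength b w := by
  suffices h : ∀ v : (rootSystem H).weylGroup, weylLength b v⁻¹ ≤ weylLength b v from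
    le_antisymm (h w) (by simpa using h w⁻¹)
  intro v
  obtain ⟨l, hl, hlen, rfl⟩ := exists_list_length_eq_weylLength b v
  rw [← hlen, List.prod_inv_reverse, List.map_map, ← List.map_reverse, ← List.length_reverse]
  have : ((fun x => x⁻¹) ∘ weylGroup.ofIdx (rootSystem H)) = weylGroup.ofIdx (rootSystem H) :=
    funext fun j => weylGroup.ofIdx_inv j
  rw [this]
  exact weylLength_le b _ (by simpa using hl)

theorem weylLength_mul_ofIdx_lt {b : (rootSystem H).Base} {i : H.root} (hi : i ∈ b.support)
    {w : (rootSystem H).weylGroup} (h : ¬ b.IsPos (w • i)) :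
    weylLength b (w * weylGroup.ofIdx (rootSystem H) i) < weylLength b w := by
  obtain ⟨l, hl, hlen, rfl⟩ := exists_list_length_eq_weylLength b w
  obtain ⟨m, hm, hml, hprod⟩ := Base.exists_list_prod_eq_mul_ofIdx hi l hl h
  rw [← hprod, ← hlen]
  have := weylLength_le b m hm
  omega

/-- Otherwise `w s_i`, in the same double coset, would be shorter. -/
theorem IsMinimalRep.isPos_smul {b : (rootSystem H).Base} {i : H.root} (hi : i ∈ b.support)
    {w : (rootSystem H).weylGroup} (hw : IsMinimalRep b i w) : b.IsPos (w • i) := by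
  by_contra h
  refine (weylLength_mul_ofIdx_lt hi h).not_ge (hw _ ?_)
  exact DoubleCoset.mem_doubleCoset.2
    ⟨1, one_mem _, _, Subgroup.subset_closure rfl, by rw [one_mul]⟩

theorem IsMinimalRep.isPos_inv_smul {b : (rootSystem H).Base} {i : H.root} (hi : i ∈ b.support)
    {w : (rootSystem H).weylGroup} (hw : IsMinimalRep b i w) : b.IsPos (w⁻¹ • i) := by
  by_contra h
  have := weylLength_mul_ofIdx_lt hi h
  rw [weylLength_inv, ← weylLength_inv, mul_inv_rev, inv_inv, weylGroup.ofIdx_inv] at this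
  refine this.not_ge (hw _ ?_)
  exact DoubleCoset.mem_doubleCoset.2
    ⟨_, Subgroup.subset_closure rfl, 1, one_mem _, by rw [mul_one]⟩

end DiagOrbit

end

noncomputable section

namespace DiagOrbit

/-! ### The adjoint group -/

section AdjointGroup

variable {𝔤 : Type*} [LieRing 𝔤] [LieAlgebra ℂ 𝔤]

theorem exists_lieEquiv_eq_expAd {x : 𝔤} (hx : IsNilpotent (ad ℂ 𝔤 x)) :
    ∃ g : 𝔤 ≃ₗ⁅ℂ⁆ 𝔤, ∀ y, g y = expAd x y := by
  -- `LieDerivation.exp` uses rational scalars; they are restricted from ℂ, so that both exponential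
  -- sums have the same coefficients.
  let _ : Module ℚ 𝔤 := Module.compHom 𝔤 (algebraMap ℚ ℂ)
  have hq (q : ℚ) (y : 𝔤) : q • y = (q : ℂ) • y := rfl
  let _ : LieAlgebra ℚ 𝔤 := { lie_smul := fun q y z => by rw [hq, hq, lie_smul] }
  have had : (LieDerivation.ad ℂ 𝔤 x).toLinearMap = ad ℂ 𝔤 x := by ext; simp
  refine ⟨LieDerivation.exp (LieDerivation.ad ℂ 𝔤 x) (had ▸ hx), fun y => ?_⟩
  rw [LieDerivation.exp_map_apply, had, IsNilpotent.exp, expAd, LinearMap.sum_apply, LinearMap.sum_apply]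
  refine Finset.sum_congr rfl fun k _ => ?_
  rw [LinearMap.smul_apply, LinearMap.smul_apply, hq]
  simp

theorem expAd_apply_of_lie_lie_lie_eq_zero {x y : 𝔤} (hx : IsNilpotent (ad ℂ 𝔤 x))
    (h : ⁅x, ⁅x, ⁅x, y⁆⁆⁆ = 0) : expAd x y = y + ⁅x, y⁆ + (2⁻¹ : ℂ) • ⁅x, ⁅x, y⁆⁆ := by
  have h0 (k : ℕ) : ((ad ℂ 𝔤 x) ^ (k + 3)) y = 0 := by
    rw [pow_add, Module.End.mul_apply]
    have : ((ad ℂ 𝔤 x) ^ 3) y = 0 := by simpa [pow_succ] using h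
    rw [this, map_zero]
  set N := nilpotencyClass (ad ℂ 𝔤 x) with hN
  have hpow : (ad ℂ 𝔤 x) ^ N = 0 := pow_nilpotencyClass hx
  have key : expAd x y =
      ∑ k ∈ Finset.range 3, ((k.factorial : ℂ)⁻¹) • ((ad ℂ 𝔤 x) ^ k) y := by
    -- Padding the sum to `N + 3` terms and then cutting it to 3 avoids comparing `N` with 3.
    have h1 : expAd x y = ∑ k ∈ Finset.range (N + 3), ((k.factorial : ℂ)⁻¹) • ((ad ℂ 𝔤 x) ^ k) y := by
      rw [expAd, LinearMap.sum_apply, ← hN, Finset.sum_range_add]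
      refine (add_eq_left.2 ?_).symm
      refine Finset.sum_eq_zero fun k _ => ?_
      rw [pow_add, hpow, zero_mul, LinearMap.zero_apply, smul_zero]
    rw [h1, add_comm, Finset.sum_range_add, add_eq_left]
    refine Finset.sum_eq_zero fun k _ => ?_
    rw [add_comm, h0, smul_zero]
  rw [key]
  simp [Finset.sum_range_succ, pow_succ, Nat.factorial]

theorem exists_mem_adjointGroup_eq_expAd {x : 𝔤} (hx : IsNilpotent (ad ℂ 𝔤 x)) :
    ∃ g ∈ adjointGroup 𝔤, ∀ y, g y = expAd x y := by
  obtain ⟨g, hg⟩ := exists_lieEquiv_eq_expAd hx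
  exact ⟨g.toLinearEquiv, Subgroup.subset_closure ⟨x, hx, LinearMap.ext hg⟩, hg⟩

theorem map_lie_of_mem_adjointGroup {g : 𝔤 ≃ₗ[ℂ] 𝔤} (hg : g ∈ adjointGroup 𝔤) (x y : 𝔤) :
    g ⁅x, y⁆ = ⁅g x, g y⁆ := by
  induction hg using Subgroup.closure_induction generalizing x y with
  | mem g hg =>
    obtain ⟨z, hz, hgz⟩ := hg
    obtain ⟨g', hg'⟩ := exists_lieEquiv_eq_expAd hz
    have h (u : 𝔤) : g u = g' u := by rw [hg', ← hgz]; rfl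
    rw [h, h, h, LieEquiv.map_lie]
  | one => rfl
  | mul g k _ _ hg hk => rw [LinearEquiv.mul_apply, hk, hg]; rfl
  | inv g _ hg =>
    apply g.injective
    rw [hg]
    simp only [← LinearEquiv.mul_apply, mul_inv_cancel]
    rfl

theorem killingForm_map_map_of_mem_adjointGroup {g : 𝔤 ≃ₗ[ℂ] 𝔤} (hg : g ∈ adjointGroup 𝔤)
    (x y : 𝔤) : killingForm ℂ 𝔤 (g x) (g y) = killingForm ℂ 𝔤 x y :=
  killingForm_of_equiv_apply
    ({ g with map_lie' := map_lie_of_mem_adjointGroup hg _ _ } : 𝔤 ≃ₗ⁅ℂ⁆ 𝔤) x y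

/-- The element `exp (z e) exp (-z⁻¹ f) exp (z e)` attached to an `𝔰𝔩₂`-triple. -/
theorem exists_mem_adjointGroup_reflection {h e f : 𝔤} (t : IsSl2Triple h e f)
    (he : IsNilpotent (ad ℂ 𝔤 e)) (hf : IsNilpotent (ad ℂ 𝔤 f)) {z : ℂ} (hz : z ≠ 0) :
    ∃ g ∈ adjointGroup 𝔤, g f = -(z ^ 2) • e ∧
      ∀ (k : 𝔤) (a : ℂ), ⁅k, e⁆ = a • e → ⁅k, f⁆ = -(a • f) → g k = k - a • h := by
  -- In `SL₂` this element is the matrix with rows `(0, z)` and `(-z⁻¹, 0)`. Its effect on `k` does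
  -- not depend on `z`, while `f` goes to `-z² e`; torus elements arise by comparing two values of
  -- `z`.
  have he' : IsNilpotent (ad ℂ 𝔤 (z • e)) := by rw [map_smul]; exact he.smul z
  have hf' : IsNilpotent (ad ℂ 𝔤 (-z⁻¹ • f)) := by rw [map_smul]; exact hf.smul _
  obtain ⟨g₁, hg₁, h₁⟩ := exists_mem_adjointGroup_eq_expAd he'
  obtain ⟨g₂, hg₂, h₂⟩ := exists_mem_adjointGroup_eq_expAd hf'
  have hef : ⁅e, f⁆ = h := t.lie_e_f
  have hfe : ⁅f, e⁆ = -h := by rw [← lie_skew, hef]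
  have hhe : ⁅h, e⁆ = (2 : ℂ) • e := t.lie_h_e_smul ℂ
  have hhf : ⁅h, f⁆ = -((2 : ℂ) • f) := t.lie_lie_smul_f ℂ
  have heh : ⁅e, h⁆ = -((2 : ℂ) • e) := by rw [← lie_skew, hhe]
  have hfh : ⁅f, h⁆ = (2 : ℂ) • f := by rw [← lie_skew, hhf, neg_neg]
  have e₁ : g₁ e = e := by
    rw [h₁, expAd_apply_of_lie_lie_lie_eq_zero he'] <;> simp
  have f₁ : g₁ f = f + z • h - z ^ 2 • e := by
    rw [h₁, expAd_apply_of_lie_lie_lie_eq_zero he'] <;>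
    simp only [smul_lie, lie_smul, hef, heh, lie_neg, lie_self, smul_zero, neg_zero]
    module
  have k₁ {k : 𝔤} {a : ℂ} (hke : ⁅k, e⁆ = a • e) : g₁ k = k - (a * z) • e := by
    have hek : ⁅e, k⁆ = -(a • e) := by rw [← lie_skew, hke]
    rw [h₁, expAd_apply_of_lie_lie_lie_eq_zero he'] <;>
    simp only [smul_lie, lie_smul, hek, lie_neg, lie_self, lie_zero, smul_zero, neg_zero]
    module
  have e₂ : g₂ e = e + z⁻¹ • h - (z⁻¹ ^ 2) • f := by
    rw [h₂, expAd_apply_of_lie_lie_lie_eq_zero hf'] <;>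
    simp only [smul_lie, lie_smul, hfe, hfh, lie_neg, lie_self, smul_zero, neg_zero]
    module
  have f₂ : g₂ f = f := by
    rw [h₂, expAd_apply_of_lie_lie_lie_eq_zero hf'] <;> simp
  have k₂ {k : 𝔤} {a : ℂ} (hkf : ⁅k, f⁆ = -(a • f)) : g₂ k = k - (a * z⁻¹) • f := by
    have hfk : ⁅f, k⁆ = a • f := by rw [← lie_skew, hkf, neg_neg]
    rw [h₂, expAd_apply_of_lie_lie_lie_eq_zero hf'] <;>
    simp only [smul_lie, lie_smul, hfk, lie_self, lie_zero, smul_zero]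
    module
  refine ⟨g₁ * g₂ * g₁, mul_mem (mul_mem hg₁ hg₂) hg₁, ?_, fun k a hke hkf => ?_⟩
  · rw [LinearEquiv.mul_apply, LinearEquiv.mul_apply, f₁, map_sub, map_add, map_smul, map_smul,
      k₂ hhf, e₂, f₂]
    have : f + z • (h - (2 * z⁻¹) • f) - z ^ 2 • (e + z⁻¹ • h - z⁻¹ ^ 2 • f) = -(z ^ 2) • e := by
      match_scalars <;> field_simp <;> ring
    rw [this, map_smul, e₁]
  · rw [LinearEquiv.mul_apply, LinearEquiv.mul_apply, k₁ hke, map_sub, map_smul, k₂ hkf, e₂]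
    have : k - (a * z⁻¹) • f - (a * z) • (e + z⁻¹ • h - z⁻¹ ^ 2 • f) = k - a • h - (a * z) • e := by
      match_scalars <;> field_simp
      ring
    rw [this, map_sub, map_sub, map_smul, map_smul, k₁ hke, k₁ hhe, e₁]
    module

end AdjointGroup

/-! ### Root triples and the torus action on a root space. -/

variable {𝔤 : Type*} [LieRing 𝔤] [LieAlgebra ℂ 𝔤] [FiniteDimensional ℂ 𝔤]
  {H : LieSubalgebra ℂ 𝔤} [H.IsCartanSubalgebra]

theorem root_ne_zero (i : H.root) : (i.1 : H → ℂ) ≠ 0 :=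
  LieSubalgebra.isNonZero_coe_root i

variable [LieAlgebra.IsSemisimple ℂ 𝔤]

/-- The Cartan subalgebra acts diagonalizably, so generalized weight spaces are genuine ones. -/
theorem mem_rootSpace_iff {χ : H → ℂ} {x : 𝔤} :
    x ∈ rootSpace H χ ↔ ∀ h : H, ⁅(h : 𝔤), x⁆ = χ h • x := by
  refine ⟨fun hx h => lie_eq_smul_of_mem_rootSpace hx h, fun hx => ?_⟩
  exact LieModule.weightSpace_le_genWeightSpace 𝔤 χ ((LieModule.mem_weightSpace χ x).2 hx)

/-- An `𝔰𝔩₂`-triple whose nilpotent elements lie in the root spaces of `±α_i`. -/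
structure IsRootTriple (i : H.root) (h e f : 𝔤) : Prop where
  triple : IsSl2Triple h e f
  e_mem : e ∈ rootSpace H (i.1 : H → ℂ)
  f_mem : f ∈ rootSpace H (-(i.1 : H → ℂ))

theorem exists_isRootTriple (i : H.root) : ∃ h e f : 𝔤, IsRootTriple i h e f := by
  obtain ⟨h, e, f, t, he, hf⟩ :=
    exists_isSl2Triple_of_weight_isNonZero (LieSubalgebra.isNonZero_coe_root i)
  exact ⟨h, e, f, t, he, hf⟩

namespace IsRootTriple

variable {i : H.root} {h e f : 𝔤}

theorem h_eq_coroot (t : IsRootTriple i h e f) : h = coroot i.1 :=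
  t.triple.h_eq_coroot (LieSubalgebra.isNonZero_coe_root i) t.e_mem t.f_mem

theorem h_mem (t : IsRootTriple i h e f) : h ∈ H := t.h_eq_coroot ▸ (coroot i.1).2

theorem lie_e (t : IsRootTriple i h e f) (k : H) :
    ⁅(k : 𝔤), e⁆ = i.1 k • e := mem_rootSpace_iff.1 t.e_mem k

theorem lie_f (t : IsRootTriple i h e f) (k : H) : ⁅(k : 𝔤), f⁆ = -(i.1 k • f) := by
  simpa using mem_rootSpace_iff.1 t.f_mem k

theorem exists_eq_smul_e (t : IsRootTriple i h e f) {x : 𝔤} (hx : x ∈ rootSub i) :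
    ∃ a : ℂ, x = a • e := by
  have := (finrank_eq_one_iff_of_nonzero' (⟨e, t.e_mem⟩ : rootSpace H (i.1 : H → ℂ))
    (fun h0 => t.triple.e_ne_zero (congrArg Subtype.val h0))).1
    (finrank_rootSpace_eq_one i.1 (LieSubalgebra.isNonZero_coe_root i)) ⟨x, hx⟩
  obtain ⟨a, ha⟩ := this
  exact ⟨a, (congrArg Subtype.val ha).symm⟩

theorem exists_eq_smul_f (t : IsRootTriple i h e f) {x : 𝔤} (hx : x ∈ negRootSub i) :
    ∃ a : ℂ, x = a • f := by
  have := (finrank_eq_one_iff_of_nonzero' (⟨f, t.f_mem⟩ : rootSpace H (-(i.1 : H → ℂ)))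
    (fun h0 => t.triple.f_ne_zero (congrArg Subtype.val h0))).1
    (finrank_rootSpace_eq_one (-i.1) (LieSubalgebra.isNonZero_coe_root i).neg) ⟨x, hx⟩
  obtain ⟨a, ha⟩ := this
  exact ⟨a, (congrArg Subtype.val ha).symm⟩

theorem root_h : i.1 (coroot i.1) = 2 := root_apply_coroot (LieSubalgebra.isNonZero_coe_root i)

theorem exists_mem_adjointGroup (t : IsRootTriple i h e f) {z : ℂ} (hz : z ≠ 0) :
    ∃ g ∈ adjointGroup 𝔤, g f = -(z ^ 2) • e ∧
      ∀ k : H, g (k : 𝔤) = (k - i.1 k • coroot i.1 : H) := by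
  obtain ⟨g, hg, hgf, hk⟩ := exists_mem_adjointGroup_reflection t.triple
    (isNilpotent_ad_of_mem_rootSpace H (root_ne_zero i) t.e_mem)
    (isNilpotent_ad_of_mem_rootSpace H (neg_ne_zero.2 (root_ne_zero i)) t.f_mem) hz
  refine ⟨g, hg, hgf, fun k => ?_⟩
  rw [hk k _ (t.lie_e k) (t.lie_f k), t.h_eq_coroot]
  rfl

/-- The torus acts on a root space through all nonzero scalars. -/
theorem exists_mem_torus (t : IsRootTriple i h e f) {c : ℂ} (hc : c ≠ 0) :
    ∃ s ∈ torus H, s e = c • e := by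
  -- With `z² = c`, the quotient of the reflection elements for `z` and 1 works: both induce the
  -- same involution of `H`, so it centralizes `H`, and it sends `e` to `-f` and then to `z² e`.
  obtain ⟨z, hz⟩ := IsAlgClosed.exists_pow_nat_eq c (n := 2) (by norm_num)
  have hz0 : z ≠ 0 := by rintro rfl; exact hc (by simpa using hz.symm)
  obtain ⟨g, hg, hgf, hgk⟩ := t.exists_mem_adjointGroup hz0
  obtain ⟨g', hg', hgf', hgk'⟩ := t.exists_mem_adjointGroup one_ne_zero
  have inv_e : g'⁻¹ e = -f := by
    apply g'.injective
    rw [← LinearEquiv.mul_apply, mul_inv_cancel, map_neg, hgf']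
    simp
  have hinvol (k : H) : (k - i.1 k • coroot i.1) -
      i.1 (k - i.1 k • coroot i.1) • coroot i.1 = k := by
    have : i.1 (k - i.1 k • coroot i.1) = -i.1 k := by
      simp only [← LieModule.Weight.toLinear_apply, map_sub, map_smul]
      simp only [LieModule.Weight.toLinear_apply, root_h, smul_eq_mul]
      ring
    rw [this]
    module
  have inv_k (k : H) : g'⁻¹ (k : 𝔤) = (k - i.1 k • coroot i.1 : H) := by
    apply g'.injective
    rw [← LinearEquiv.mul_apply, mul_inv_cancel, hgk', hinvol]
    rfl
  refine ⟨g * g'⁻¹, ⟨mul_mem hg ((adjointGroup 𝔤).inv_mem hg'), fun k hk => ?_⟩, ?_⟩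
  · rw [LinearEquiv.mul_apply, inv_k ⟨k, hk⟩, hgk, hinvol]
  · rw [LinearEquiv.mul_apply, inv_e, map_neg, hgf, ← hz]
    module

end IsRootTriple

/-! ### Representatives of Weyl group elements -/

theorem IsLift.one : IsLift (1 : (rootSystem H).weylGroup) 1 :=
  ⟨one_mem _, fun h => ⟨h, rfl, fun α => by rw [one_smul]⟩⟩

theorem IsLift.mul {w v : (rootSystem H).weylGroup} {n m : 𝔤 ≃ₗ[ℂ] 𝔤} (hn : IsLift w n)
    (hm : IsLift v m) : IsLift (w * v) (n * m) := by
  refine ⟨mul_mem hn.1 hm.1, fun h => ?_⟩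
  obtain ⟨h', hh', hα⟩ := hm.2 h
  obtain ⟨h'', hh'', hβ⟩ := hn.2 h'
  refine ⟨h'', by rw [LinearEquiv.mul_apply, hh', hh''], fun α => ?_⟩
  rw [mul_smul, hβ, hα]

theorem isLift_one_of_mem_torus {s : 𝔤 ≃ₗ[ℂ] 𝔤} (hs : s ∈ torus H) :
    IsLift (1 : (rootSystem H).weylGroup) s :=
  ⟨hs.1, fun h => ⟨h, hs.2 h h.2, fun α => by rw [one_smul]⟩⟩

theorem exists_isLift_ofIdx (i : H.root) :
    ∃ n, IsLift (weylGroup.ofIdx (rootSystem H) i) n := by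
  obtain ⟨h, e, f, t⟩ := exists_isRootTriple i
  obtain ⟨g, hg, -, hk⟩ := t.exists_mem_adjointGroup one_ne_zero
  refine ⟨g, hg, fun k => ⟨_, hk k, fun α => ?_⟩⟩
  have hr : (rootSystem H).root (weylGroup.ofIdx (rootSystem H) i • α) =
      (rootSystem H).reflection i ((rootSystem H).root α) := root_reflectionPerm _ _ _
  have := LinearMap.congr_fun hr (k - i.1 k • coroot i.1)
  rw [reflection_apply] at this
  simp only [rootSystem_root_apply, LieModule.Weight.toLinear_apply] at this
  rw [this]
  simp only [LinearMap.sub_apply, LinearMap.smul_apply, map_sub, map_smul, smul_eq_mul]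
  have h2 := IsRootTriple.root_h (i := i)
  simp [h2]
  ring

theorem exists_isLift (w : (rootSystem H).weylGroup) : ∃ n, IsLift w n := by
  obtain ⟨g, hg⟩ := w
  induction hg using weylGroup.induction with
  | mem j => exact exists_isLift_ofIdx j
  | one => exact ⟨1, IsLift.one⟩
  | mul x y hx hy h₁ h₂ =>
    obtain ⟨n, hn⟩ := h₁
    obtain ⟨m, hm⟩ := h₂
    exact ⟨n * m, hn.mul hm⟩

namespace IsLift

variable {w : (rootSystem H).weylGroup} {n : 𝔤 ≃ₗ[ℂ] 𝔤}

/-- `IsLift` only gives that `n` maps `H` into itself; injectivity and finite dimension make this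
map onto. -/
theorem exists_apply_eq (hn : IsLift w n) (k : H) : ∃ h : H, n (h : 𝔤) = k := by
  have hmem : ∀ x ∈ H.toSubmodule, (n : 𝔤 →ₗ[ℂ] 𝔤) x ∈ H.toSubmodule := fun x hx => by
    obtain ⟨h', hh', -⟩ := hn.2 ⟨x, hx⟩
    change n x ∈ H
    rw [hh']
    exact h'.2
  have hinj : Function.Injective ((n : 𝔤 →ₗ[ℂ] 𝔤).restrict hmem) := fun x y hxy =>
    Subtype.ext (n.injective (congrArg Subtype.val hxy))
  obtain ⟨h, hh⟩ := LinearMap.injective_iff_surjective.1 hinj k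
  exact ⟨h, congrArg Subtype.val hh⟩

theorem inv (hn : IsLift w n) : IsLift w⁻¹ n⁻¹ := by
  refine ⟨inv_mem hn.1, fun k => ?_⟩
  obtain ⟨h, hh⟩ := hn.exists_apply_eq k
  obtain ⟨h', hh', hα⟩ := hn.2 h
  obtain rfl : h' = k := Subtype.ext (hh'.symm.trans hh)
  refine ⟨h, n.injective ?_, fun α => ?_⟩
  · rw [← LinearEquiv.mul_apply, mul_inv_cancel, hh]; rfl
  · rw [← hα, smul_inv_smul]

theorem apply_mem_rootSpace (hn : IsLift w n) {χ χ' : H → ℂ}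
    (h : ∀ k k' : H, n (k : 𝔤) = k' → χ' k' = χ k) {x : 𝔤} (hx : x ∈ rootSpace H χ) :
    n x ∈ rootSpace H χ' := by
  refine mem_rootSpace_iff.2 fun k' => ?_
  obtain ⟨k, hk⟩ := hn.exists_apply_eq k'
  rw [← hk, ← map_lie_of_mem_adjointGroup hn.1, mem_rootSpace_iff.1 hx, map_smul, h k k' hk]

theorem smul_root_apply (hn : IsLift w n) (α : H.root) {k k' : H} (h : n (k : 𝔤) = k') :
    (w • α).1 k' = α.1 k := by
  obtain ⟨h', hh', hα⟩ := hn.2 k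
  obtain rfl : h' = k' := Subtype.ext (hh'.symm.trans h)
  exact hα α

theorem apply_mem_rootSub (hn : IsLift w n) {α : H.root} {x : 𝔤} (hx : x ∈ rootSub α) :
    n x ∈ rootSub (w • α) :=
  hn.apply_mem_rootSpace (fun _ _ h => hn.smul_root_apply α h) hx

theorem apply_mem_negRootSub (hn : IsLift w n) {α : H.root} {x : 𝔤} (hx : x ∈ negRootSub α) :
    n x ∈ negRootSub (w • α) :=
  hn.apply_mem_rootSpace (fun _ _ h => congrArg Neg.neg (hn.smul_root_apply α h)) hx

end IsLift

end DiagOrbit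

end

/-! ### Traceless matrices and Killing-form coordinates. -/

noncomputable section

namespace DiagOrbit

variable {𝔤 : Type*} [LieRing 𝔤] [LieAlgebra ℂ 𝔤]

/-- The traceless matrix with rows `(a, b)` and `(c, -a)`. -/
def slMk (a b c : ℂ) : SpecialLinear.sl (Fin 2) ℂ :=
  ⟨!![a, b; c, -a], by
    change _ ∈ LinearMap.ker (Matrix.traceLinearMap (Fin 2) ℂ ℂ)
    rw [LinearMap.mem_ker]
    simp [Matrix.trace_fin_two]⟩

theorem slMk_inj {a b c a' b' c' : ℂ} : slMk a b c = slMk a' b' c' ↔ a = a' ∧ b = b' ∧ c = c' := by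
  refine ⟨fun h => ?_, fun ⟨h₁, h₂, h₃⟩ => by rw [h₁, h₂, h₃]⟩
  have h' := congrArg Subtype.val h
  exact ⟨by simpa [slMk] using congrFun (congrFun h' 0) 0,
    by simpa [slMk] using congrFun (congrFun h' 0) 1,
    by simpa [slMk] using congrFun (congrFun h' 1) 0⟩

theorem slMk_add (a b c a' b' c' : ℂ) :
    slMk a b c + slMk a' b' c' = slMk (a + a') (b + b') (c + c') := by
  apply Subtype.ext
  ext i j
  fin_cases i <;> fin_cases j <;> simp [slMk, add_comm]

theorem smul_slMk (r a b c : ℂ) : r • slMk a b c = slMk (r * a) (r * b) (r * c) := by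
  apply Subtype.ext
  ext i j
  fin_cases i <;> fin_cases j <;> simp [slMk]

theorem lie_slMk (a b c a' b' c' : ℂ) :
    ⁅slMk a b c, slMk a' b' c'⁆ =
      slMk (b * c' - b' * c) (2 * (a * b' - a' * b)) (2 * (c * a' - c' * a)) := by
  apply Subtype.ext
  rw [SpecialLinear.sl_bracket]
  ext i j
  fin_cases i <;> fin_cases j <;> simp [slMk] <;> ring

theorem exists_eq_slMk (A : SpecialLinear.sl (Fin 2) ℂ) : ∃ a b c, A = slMk a b c := by
  refine ⟨A.1 0 0, A.1 0 1, A.1 1 0, Subtype.ext ?_⟩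
  have h : Matrix.trace A.1 = 0 := A.2
  rw [Matrix.trace_fin_two] at h
  ext i j
  fin_cases i <;> fin_cases j <;> simp [slMk]
  linear_combination h

theorem slMk_mem_upperSl2 {a b c : ℂ} : slMk a b c ∈ upperSl2 ↔ c = 0 := by
  change (slMk a b c).1 1 0 = 0 ↔ _
  simp [slMk]

theorem slMk_mem_lowerSl2 {a b c : ℂ} : slMk a b c ∈ lowerSl2 ↔ b = 0 := by
  change (slMk a b c).1 0 1 = 0 ↔ _
  simp [slMk]

/-- The coordinates of the component of `x` along an `𝔰𝔩₂`-triple `h, e, f`, computed with the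
Killing form. -/
def slCoord (h e f : 𝔤) : 𝔤 →ₗ[ℂ] SpecialLinear.sl (Fin 2) ℂ where
  -- The form pairs `e` with `f`, so pairing with `f` reads the coefficient of `e`; the factor 1/2
  -- comes from κ(h,h) = 2κ(e,f).
  toFun x := slMk ((killingForm ℂ 𝔤 e f)⁻¹ * (2⁻¹ * killingForm ℂ 𝔤 x h))
    ((killingForm ℂ 𝔤 e f)⁻¹ * killingForm ℂ 𝔤 x f) ((killingForm ℂ 𝔤 e f)⁻¹ * killingForm ℂ 𝔤 x e)
  map_add' x y := by
    rw [slMk_add]; simp only [map_add, LinearMap.add_apply, mul_add]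
  map_smul' r x := by
    rw [RingHom.id_apply, smul_slMk]
    simp only [map_smul, LinearMap.smul_apply, smul_eq_mul]
    rw [slMk_inj]
    refine ⟨?_, ?_, ?_⟩ <;> ring

theorem slCoord_apply (h e f x : 𝔤) : slCoord h e f x =
    slMk ((killingForm ℂ 𝔤 e f)⁻¹ * (2⁻¹ * killingForm ℂ 𝔤 x h))
    ((killingForm ℂ 𝔤 e f)⁻¹ * killingForm ℂ 𝔤 x f)
    ((killingForm ℂ 𝔤 e f)⁻¹ * killingForm ℂ 𝔤 x e) := rfl

variable [FiniteDimensional ℂ 𝔤] {H : LieSubalgebra ℂ 𝔤} [H.IsCartanSubalgebra]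

theorem mem_rootSpace_zero {x : 𝔤} (hx : x ∈ H) : x ∈ rootSpace H (0 : H → ℂ) := by
  rwa [rootSpace_zero_eq ℂ 𝔤 H, LieSubalgebra.mem_toLieSubmodule]

theorem killingForm_eq_zero {χ ψ : H → ℂ} {x y : 𝔤} (hx : x ∈ rootSpace H χ)
    (hy : y ∈ rootSpace H ψ) (h : χ + ψ ≠ 0) : killingForm ℂ 𝔤 x y = 0 :=
  killingForm_apply_eq_zero_of_mem_rootSpace_of_add_ne_zero ℂ 𝔤 H hx hy h

theorem root_coe_inj {i j : H.root} : (i.1 : H → ℂ) = j.1 ↔ i = j := by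
  refine ⟨fun h => Subtype.ext (DFunLike.coe_injective h), fun h => by rw [h]⟩

theorem root_add_self_ne_zero (i : H.root) : (i.1 : H → ℂ) + i.1 ≠ 0 := by
  rw [← two_smul ℂ]
  exact smul_ne_zero two_ne_zero (root_ne_zero i)

variable [LieAlgebra.IsSemisimple ℂ 𝔤]

theorem root_add_root_ne_zero {b : (rootSystem H).Base} {i j : H.root} (hi : b.IsPos i)
    (hj : b.IsPos j) : (i.1 : H → ℂ) + j.1 ≠ 0 := by
  intro h
  let := (rootSystem H).indexNeg
  have : i = -j := by
    apply (rootSystem H).root.injective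
    rw [indexNeg_neg, root_reflectionPerm, reflection_apply_self]
    ext k
    simpa using eq_neg_of_add_eq_zero_left (congrFun h k)
  exact (Base.IsPos.neg_iff_not b j).1 (this ▸ hi) hj

/-! ### Orthogonality relations for the parabolic subalgebras -/

section Orthogonal

variable {b : (rootSystem H).Base} {i : H.root}

/-- `𝔤_γ` pairs nontrivially only with `𝔤_{-γ}`, which is not among the summands of `𝔭_i`. -/
theorem killingForm_parabolic_eq_zero {γ : H.root} (hγ : b.IsPos γ) (hγi : γ ≠ i) {x y : 𝔤}
    (hx : x ∈ parabolic b i) (hy : y ∈ rootSub γ) : killingForm ℂ 𝔤 x y = 0 := by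
  suffices parabolic b i ≤ LinearMap.ker ((killingForm ℂ 𝔤).flip y) from this hx
  refine sup_le (sup_le (fun z hz => ?_) (iSup₂_le fun β hβ z hz => ?_)) fun z hz => ?_
  · exact killingForm_eq_zero (mem_rootSpace_zero hz) hy (by simp [root_ne_zero γ])
  · exact killingForm_eq_zero hz hy (root_add_root_ne_zero hβ hγ)
  · refine killingForm_eq_zero hz hy fun h => hγi ?_
    exact (root_coe_inj.1 (neg_add_eq_zero.1 h)).symm

theorem killingForm_oppParabolic_eq_zero {γ : H.root} (hγ : b.IsPos γ) (hγi : γ ≠ i) {x y : 𝔤}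
    (hx : x ∈ oppParabolic b i) (hy : y ∈ negRootSub γ) : killingForm ℂ 𝔤 x y = 0 := by
  suffices oppParabolic b i ≤ LinearMap.ker ((killingForm ℂ 𝔤).flip y) from this hx
  refine sup_le (sup_le (fun z hz => ?_) (iSup₂_le fun β hβ z hz => ?_)) fun z hz => ?_
  · exact killingForm_eq_zero (mem_rootSpace_zero hz) hy (by simp [root_ne_zero γ])
  · refine killingForm_eq_zero hz hy ?_
    rw [← neg_add, neg_ne_zero]
    exact root_add_root_ne_zero hβ hγ
  · refine killingForm_eq_zero hz hy fun h => hγi ?_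
    exact (root_coe_inj.1 (add_neg_eq_zero.1 h)).symm

theorem parabolic_le_levi_sup_nilrad : parabolic b i ≤ (levi i).toSubmodule ⊔ nilrad b i := by
  refine sup_le (sup_le ?_ (iSup₂_le fun β hβ => ?_)) ?_
  · exact le_sup_left.trans (le_sup_left.trans le_sup_left)
  · by_cases h : β = i
    · subst h
      exact le_sup_right.trans (le_sup_left.trans le_sup_left)
    · exact (le_iSup₂_of_le (f := fun β (_ : b.IsPos β ∧ β ≠ i) => rootSub β) β ⟨hβ, h⟩
        le_rfl).trans le_sup_right
  · exact le_sup_right.trans le_sup_left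

theorem oppParabolic_le_levi_sup_oppNilrad :
    oppParabolic b i ≤ (levi i).toSubmodule ⊔ oppNilrad b i := by
  refine sup_le (sup_le ?_ (iSup₂_le fun β hβ => ?_)) ?_
  · exact le_sup_left.trans (le_sup_left.trans le_sup_left)
  · by_cases h : β = i
    · subst h
      exact le_sup_right.trans le_sup_left
    · exact (le_iSup₂_of_le (f := fun β (_ : b.IsPos β ∧ β ≠ i) => negRootSub β) β ⟨hβ, h⟩
        le_rfl).trans le_sup_right
  · exact le_sup_right.trans (le_sup_left.trans le_sup_left)

theorem rootSub_le_parabolic {β : H.root} (hβ : b.IsPos β) : rootSub β ≤ parabolic b i :=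
  (le_iSup₂_of_le (f := fun β (_ : b.IsPos β) => rootSub β) β hβ le_rfl).trans
    (le_sup_right.trans le_sup_left)

theorem negRootSub_le_oppParabolic {β : H.root} (hβ : b.IsPos β) :
    negRootSub β ≤ oppParabolic b i :=
  (le_iSup₂_of_le (f := fun β (_ : b.IsPos β) => negRootSub β) β hβ le_rfl).trans
    (le_sup_right.trans le_sup_left)

theorem cartan_le_parabolic : H.toSubmodule ≤ parabolic b i := le_sup_left.trans le_sup_left

theorem cartan_le_oppParabolic : H.toSubmodule ≤ oppParabolic b i := le_sup_left.trans le_sup_left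

theorem levi_le_parabolic (hi : i ∈ b.support) : (levi i).toSubmodule ≤ parabolic b i :=
  sup_le (sup_le cartan_le_parabolic (rootSub_le_parabolic (Base.isPos_of_mem_support hi)))
    le_sup_right

theorem levi_le_oppParabolic (hi : i ∈ b.support) : (levi i).toSubmodule ≤ oppParabolic b i :=
  sup_le (sup_le cartan_le_oppParabolic le_sup_right)
    (negRootSub_le_oppParabolic (Base.isPos_of_mem_support hi))

end Orthogonal

theorem cartan_le_levi (i : H.root) : H.toSubmodule ≤ (levi i).toSubmodule :=
  le_sup_left.trans le_sup_left

theorem rootSub_le_levi (i : H.root) : rootSub i ≤ (levi i).toSubmodule :=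
  le_sup_right.trans le_sup_left

theorem negRootSub_le_levi (i : H.root) : negRootSub i ≤ (levi i).toSubmodule := le_sup_right

/-! ### The coordinates on the Levi subalgebra -/

namespace IsRootTriple

variable {i : H.root} {h e f : 𝔤}

theorem killingForm_cartan_h (t : IsRootTriple i h e f) (k : H) :
    killingForm ℂ 𝔤 k h = i.1 k * killingForm ℂ 𝔤 e f := by
  rw [← t.triple.lie_e_f]
  have := LieModule.traceForm_apply_lie_apply ℂ 𝔤 𝔤 (k : 𝔤) e f
  change killingForm ℂ 𝔤 ⁅(k : 𝔤), e⁆ f = killingForm ℂ 𝔤 k ⁅e, f⁆ at this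
  rw [← this, t.lie_e, map_smul, LinearMap.smul_apply, smul_eq_mul]

theorem killingForm_e_f_ne_zero (t : IsRootTriple i h e f) : killingForm ℂ 𝔤 e f ≠ 0 := by
  intro h0
  have := lie_eq_killingForm_smul_of_mem_rootSpace_of_mem_rootSpace_neg t.e_mem t.f_mem
  rw [h0, zero_smul, t.triple.lie_e_f] at this
  exact t.triple.h_ne_zero this

theorem slCoord_cartan (t : IsRootTriple i h e f) (k : H) :
    slCoord h e f k = slMk (2⁻¹ * i.1 k) 0 0 := by
  have h0 := t.killingForm_e_f_ne_zero
  rw [slCoord_apply, t.killingForm_cartan_h,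
    killingForm_eq_zero (mem_rootSpace_zero k.2) t.e_mem (by simp [root_ne_zero i]),
    killingForm_eq_zero (mem_rootSpace_zero k.2) t.f_mem (by simp [root_ne_zero i]), slMk_inj]
  refine ⟨by field_simp, by simp, by simp⟩

theorem slCoord_e (t : IsRootTriple i h e f) : slCoord h e f e = slMk 0 1 0 := by
  have h0 := t.killingForm_e_f_ne_zero
  rw [slCoord_apply, slMk_inj, inv_mul_cancel₀ h0,
    killingForm_eq_zero t.e_mem (mem_rootSpace_zero t.h_mem) (by simp [root_ne_zero i]),
    killingForm_eq_zero t.e_mem t.e_mem (root_add_self_ne_zero i)]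
  simp

theorem slCoord_f (t : IsRootTriple i h e f) : slCoord h e f f = slMk 0 0 1 := by
  have h0 := t.killingForm_e_f_ne_zero
  have hsymm : killingForm ℂ 𝔤 f e = killingForm ℂ 𝔤 e f := LieModule.traceForm_comm ℂ 𝔤 𝔤 f e
  rw [slCoord_apply, slMk_inj, hsymm, inv_mul_cancel₀ h0,
    killingForm_eq_zero t.f_mem (mem_rootSpace_zero t.h_mem) (by simp [root_ne_zero i]),
    killingForm_eq_zero t.f_mem t.f_mem
      (by rw [← neg_add, neg_ne_zero]; exact root_add_self_ne_zero i)]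
  simp

/-- A positive root other than `α_i` is not opposite to any of the weights `0, α_i, -α_i` of the
triple. Hence `slCoord` already contains the projection of `𝔭_i` to its Levi part. -/
theorem slCoord_nilrad (t : IsRootTriple i h e f) {b : (rootSystem H).Base} (hi : i ∈ b.support)
    {x : 𝔤}
    (hx : x ∈ nilrad b i) : slCoord h e f x = 0 := by
  suffices nilrad b i ≤ LinearMap.ker (slCoord h e f) from this hx
  refine iSup₂_le fun β hβ z hz => ?_
  rw [LinearMap.mem_ker, slCoord_apply,
    killingForm_eq_zero hz (mem_rootSpace_zero t.h_mem) (by simp [root_ne_zero β]),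
    killingForm_eq_zero hz t.e_mem (root_add_root_ne_zero hβ.1 (Base.isPos_of_mem_support hi)),
    killingForm_eq_zero hz t.f_mem fun h => hβ.2 (root_coe_inj.1 (add_neg_eq_zero.1 h))]
  simpa using (smul_slMk 0 0 0 0).symm

theorem slCoord_oppNilrad (t : IsRootTriple i h e f) {b : (rootSystem H).Base}
    (hi : i ∈ b.support) {x : 𝔤}
    (hx : x ∈ oppNilrad b i) : slCoord h e f x = 0 := by
  suffices oppNilrad b i ≤ LinearMap.ker (slCoord h e f) from this hx
  refine iSup₂_le fun β hβ z hz => ?_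
  rw [LinearMap.mem_ker, slCoord_apply,
    killingForm_eq_zero hz (mem_rootSpace_zero t.h_mem) (by simp [root_ne_zero β]),
    killingForm_eq_zero hz t.e_mem fun h => hβ.2 (root_coe_inj.1 (neg_add_eq_zero.1 h)),
    killingForm_eq_zero hz t.f_mem (by
      rw [← neg_add, neg_ne_zero]
      exact root_add_root_ne_zero hβ.1 (Base.isPos_of_mem_support hi))]
  simpa using (smul_slMk 0 0 0 0).symm

theorem exists_eq_of_mem_levi (t : IsRootTriple i h e f) {x : 𝔤} (hx : x ∈ levi i) :
    ∃ (k : H) (a c : ℂ), x = k + a • e + c • f := by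
  obtain ⟨x', hx', x₂, hx₂, rfl⟩ := Submodule.mem_sup.1 (show x ∈ _ ⊔ negRootSub i from hx)
  obtain ⟨x₀, hx₀, x₁, hx₁, rfl⟩ := Submodule.mem_sup.1 hx'
  obtain ⟨a, rfl⟩ := t.exists_eq_smul_e hx₁
  obtain ⟨c, rfl⟩ := t.exists_eq_smul_f hx₂
  exact ⟨⟨x₀, hx₀⟩, a, c, rfl⟩

theorem slCoord_add_add (t : IsRootTriple i h e f) (k : H) (a c : ℂ) :
    slCoord h e f (k + a • e + c • f) = slMk (2⁻¹ * i.1 k) a c := by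
  rw [map_add, map_add, map_smul, map_smul, t.slCoord_cartan, t.slCoord_e, t.slCoord_f,
    smul_slMk, smul_slMk, slMk_add, slMk_add]
  simp

theorem lie_add_add (t : IsRootTriple i h e f) (k k' : H) (a c a' c' : ℂ) :
    ⁅(k : 𝔤) + a • e + c • f, (k' : 𝔤) + a' • e + c' • f⁆ =
      (((a * c' - a' * c) • coroot i.1 : H) : 𝔤) + (i.1 k * a' - i.1 k' * a) • e +
        (i.1 k' * c - i.1 k * c') • f := by
  have hkk : ⁅(k : 𝔤), (k' : 𝔤)⁆ = 0 := by
    simpa using mem_rootSpace_iff.1 (mem_rootSpace_zero k'.2) k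
  have hek (k : H) : ⁅e, (k : 𝔤)⁆ = -(i.1 k • e) := by rw [← lie_skew, t.lie_e]
  have hfk (k : H) : ⁅f, (k : 𝔤)⁆ = i.1 k • f := by rw [← lie_skew, t.lie_f, neg_neg]
  have hfe : ⁅f, e⁆ = -h := by rw [← lie_skew, t.triple.lie_e_f]
  simp only [add_lie, lie_add, smul_lie, lie_smul, hkk, t.lie_e, t.lie_f, hek, hfk, lie_self,
    t.triple.lie_e_f, hfe]
  have : (((a * c' - a' * c) • coroot i.1 : H) : 𝔤) = (a * c' - a' * c) • h := by
    rw [t.h_eq_coroot]; rfl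
  rw [this]
  module

theorem slCoord_lie (t : IsRootTriple i h e f) {x y : 𝔤} (hx : x ∈ levi i) (hy : y ∈ levi i) :
    slCoord h e f ⁅x, y⁆ = ⁅slCoord h e f x, slCoord h e f y⁆ := by
  obtain ⟨k, a, c, rfl⟩ := t.exists_eq_of_mem_levi hx
  obtain ⟨k', a', c', rfl⟩ := t.exists_eq_of_mem_levi hy
  rw [t.lie_add_add, t.slCoord_add_add, t.slCoord_add_add, t.slCoord_add_add, lie_slMk, slMk_inj]
  have h2 : i.1 ((a * c' - a' * c) • coroot i.1) = (a * c' - a' * c) * 2 := by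
    simp only [← LieModule.Weight.toLinear_apply, map_smul, smul_eq_mul]
    rw [LieModule.Weight.toLinear_apply, root_h]
  rw [h2]
  refine ⟨?_, ?_, ?_⟩ <;> ring

/-- Vanishing coordinates leave an element of `H` killed by `α_i`, which is central. Conversely, a
matrix commuting with the images of `e` and `f` is zero in `𝔰𝔩₂`. -/
theorem slCoord_eq_zero_iff (t : IsRootTriple i h e f) {x : levi i} :
    slCoord h e f x = 0 ↔ x ∈ LieAlgebra.center ℂ (levi i) := by
  have h00 : (0 : SpecialLinear.sl (Fin 2) ℂ) = slMk 0 0 0 := by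
    simpa using (smul_slMk 0 0 0 0)
  have hee : e ∈ levi i := rootSub_le_levi i t.e_mem
  have hff : f ∈ levi i := negRootSub_le_levi i t.f_mem
  rw [LieModule.mem_maxTrivSubmodule]
  constructor
  · obtain ⟨k, a, c, hx⟩ := t.exists_eq_of_mem_levi x.2
    rw [hx, t.slCoord_add_add, h00, slMk_inj]
    rintro ⟨hk, rfl, rfl⟩ y
    obtain ⟨k', a', c', hy⟩ := t.exists_eq_of_mem_levi y.2
    have hk0 : i.1 k = 0 := by simpa using hk
    apply Subtype.ext
    rw [LieSubalgebra.coe_bracket, hx, hy, t.lie_add_add, hk0]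
    simp
  · intro hx
    have hxe : slCoord h e f ⁅e, (x : 𝔤)⁆ = 0 := by
      rw [show ⁅e, (x : 𝔤)⁆ = 0 from congrArg Subtype.val (hx ⟨e, hee⟩), map_zero]
    have hxf : slCoord h e f ⁅f, (x : 𝔤)⁆ = 0 := by
      rw [show ⁅f, (x : 𝔤)⁆ = 0 from congrArg Subtype.val (hx ⟨f, hff⟩), map_zero]
    obtain ⟨a, c, d, hacd⟩ := exists_eq_slMk (slCoord h e f x)
    rw [t.slCoord_lie hee x.2, t.slCoord_e, hacd, lie_slMk, h00, slMk_inj] at hxe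
    rw [t.slCoord_lie hff x.2, t.slCoord_f, hacd, lie_slMk, h00, slMk_inj] at hxf
    rw [hacd, h00, slMk_inj]
    refine ⟨by simpa using hxe.2.1, by simpa using hxf.1, by simpa using hxe.1⟩

end IsRootTriple

end DiagOrbit

end

/-! ### Identification with `𝔰𝔩₂`, and the image in coordinates. -/

noncomputable section

namespace DiagOrbit

/-- The ideal is a variable equal to the kernel, so that the result applies directly to the quotient
by the center. -/
theorem exists_lieEquiv_quotient {R L L' : Type*} [CommRing R] [LieRing L] [LieAlgebra R L]
    [LieRing L'] [LieAlgebra R L'] (φ : L →ₗ⁅R⁆ L') (hφ : Function.Surjective φ) {I : LieIdeal R L}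
    (hI : I = φ.ker) :
    ∃ ψ : (L ⧸ I) ≃ₗ⁅R⁆ L', ∀ x : L, ψ (LieSubmodule.Quotient.mk x) = φ x := by
  subst hI
  refine ⟨φ.quotKerEquivRange.trans (LieEquiv.ofBijective φ.range.incl
    ⟨Subtype.val_injective, fun y => ?_⟩), fun x => rfl⟩
  obtain ⟨x, rfl⟩ := hφ y
  exact ⟨⟨φ x, φ.mem_range_self x⟩, rfl⟩

variable {𝔤 : Type*} [LieRing 𝔤] [LieAlgebra ℂ 𝔤] [FiniteDimensional ℂ 𝔤]
  [LieAlgebra.IsSemisimple ℂ 𝔤] {H : LieSubalgebra ℂ 𝔤} [H.IsCartanSubalgebra]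

theorem IsRootTriple.slCoord_surjective_levi {i : H.root} {h e f : 𝔤} (t : IsRootTriple i h e f)
    (a b c : ℂ) : (a • h + b • e + c • f) ∈ levi i ∧
      slCoord h e f (a • h + b • e + c • f) = slMk a b c := by
  constructor
  · exact add_mem (add_mem (Submodule.smul_mem _ _ (cartan_le_levi i t.h_mem))
      (Submodule.smul_mem _ _ (rootSub_le_levi i t.e_mem)))
      (Submodule.smul_mem _ _ (negRootSub_le_levi i t.f_mem))
  · have : a • h = ((a • coroot i.1 : H) : 𝔤) := by rw [t.h_eq_coroot]; rfl
    rw [this, t.slCoord_add_add, slMk_inj]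
    refine ⟨?_, rfl, rfl⟩
    simp only [← LieModule.Weight.toLinear_apply, map_smul, smul_eq_mul]
    rw [LieModule.Weight.toLinear_apply, IsRootTriple.root_h]
    ring

theorem IsRootTriple.exists_lieEquiv {i : H.root} {h e f : 𝔤} (t : IsRootTriple i h e f) :
    ∃ φ : LeviQuot i ≃ₗ⁅ℂ⁆ SpecialLinear.sl (Fin 2) ℂ,
      ∀ x : levi i, φ (leviMk i x) = slCoord h e f x := by
  let ψ : levi i →ₗ⁅ℂ⁆ SpecialLinear.sl (Fin 2) ℂ :=
    { (slCoord h e f).comp (levi i).toSubmodule.subtype with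
      map_lie' := fun {x y} => t.slCoord_lie x.2 y.2 }
  refine exists_lieEquiv_quotient ψ (fun A => ?_) ?_
  · obtain ⟨a, b, c, rfl⟩ := exists_eq_slMk A
    obtain ⟨hm, hc⟩ := t.slCoord_surjective_levi a b c
    exact ⟨⟨_, hm⟩, hc⟩
  · ext x
    rw [LieHom.mem_ker]
    exact t.slCoord_eq_zero_iff.symm

/-- An identification of `𝔩_i / Z(𝔩_i)` with `𝔰𝔩₂` that is compatible with the coordinates attached
to a triple. -/
def IsCompatible {i : H.root} (h e f : 𝔤) (φ : LeviQuot i ≃ₗ⁅ℂ⁆ SpecialLinear.sl (Fin 2) ℂ) :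
    Prop :=
  ∀ x : levi i, φ (leviMk i x) = slCoord h e f x

section Compatible

variable {i : H.root} {h e f : 𝔤}
  {φ : LeviQuot i ≃ₗ⁅ℂ⁆ SpecialLinear.sl (Fin 2) ℂ}

theorem mem_borel_iff (t : IsRootTriple i h e f) (hφ : IsCompatible h e f φ) {q : LeviQuot i} :
    q ∈ borel i ↔ φ q ∈ upperSl2 := by
  constructor
  · rintro ⟨x, hx, rfl⟩
    obtain ⟨y, hy, z, hz, hyz⟩ := Submodule.mem_sup.1
      (show (x : 𝔤) ∈ H.toSubmodule ⊔ rootSub i from hx)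
    obtain ⟨a, rfl⟩ := t.exists_eq_smul_e hz
    have := t.slCoord_add_add ⟨y, hy⟩ a 0
    rw [zero_smul, add_zero] at this
    rw [hφ, ← hyz, this, slMk_mem_upperSl2]
  · intro hq
    obtain ⟨a, b, c, hA⟩ := exists_eq_slMk (φ q)
    rw [hA, slMk_mem_upperSl2] at hq
    subst hq
    obtain ⟨hm, hc⟩ := t.slCoord_surjective_levi a b 0
    have hφq : φ (leviMk i ⟨_, hm⟩) = φ q := by rw [hφ, hA]; exact hc
    refine ⟨⟨_, hm⟩, ?_, φ.injective hφq⟩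
    · change a • h + b • e + (0 : ℂ) • f ∈ H.toSubmodule ⊔ rootSub i
      rw [zero_smul, add_zero]
      exact add_mem (Submodule.mem_sup_left (H.smul_mem a t.h_mem))
        (Submodule.mem_sup_right (Submodule.smul_mem _ b t.e_mem))

theorem mem_oppBorel_iff (t : IsRootTriple i h e f) (hφ : IsCompatible h e f φ) {q : LeviQuot i} :
    q ∈ oppBorel i ↔ φ q ∈ lowerSl2 := by
  constructor
  · rintro ⟨x, hx, rfl⟩
    obtain ⟨y, hy, z, hz, hyz⟩ := Submodule.mem_sup.1
      (show (x : 𝔤) ∈ H.toSubmodule ⊔ negRootSub i from hx)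
    obtain ⟨a, rfl⟩ := t.exists_eq_smul_f hz
    have := t.slCoord_add_add ⟨y, hy⟩ 0 a
    rw [zero_smul, add_zero] at this
    rw [hφ, ← hyz, this, slMk_mem_lowerSl2]
  · intro hq
    obtain ⟨a, b, c, hA⟩ := exists_eq_slMk (φ q)
    rw [hA, slMk_mem_lowerSl2] at hq
    subst hq
    obtain ⟨hm, hc⟩ := t.slCoord_surjective_levi a 0 c
    have hφq : φ (leviMk i ⟨_, hm⟩) = φ q := by rw [hφ, hA]; exact hc
    refine ⟨⟨_, hm⟩, ?_, φ.injective hφq⟩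
    · change a • h + (0 : ℂ) • e + c • f ∈ H.toSubmodule ⊔ negRootSub i
      rw [zero_smul, add_zero]
      exact add_mem (Submodule.mem_sup_left (H.smul_mem a t.h_mem))
        (Submodule.mem_sup_right (Submodule.smul_mem _ c t.f_mem))

theorem map_borel (t : IsRootTriple i h e f) (hφ : IsCompatible h e f φ) :
    (borel i).map (φ : LeviQuot i →ₗ[ℂ] _) = upperSl2 := by
  ext A
  refine ⟨?_, fun hA => ?_⟩
  · rintro ⟨q, hq, rfl⟩
    exact (mem_borel_iff t hφ).1 hq
  · obtain ⟨q, rfl⟩ := φ.surjective A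
    exact ⟨q, (mem_borel_iff t hφ).2 hA, rfl⟩

theorem map_oppBorel (t : IsRootTriple i h e f) (hφ : IsCompatible h e f φ) :
    (oppBorel i).map (φ : LeviQuot i →ₗ[ℂ] _) = lowerSl2 := by
  ext A
  refine ⟨?_, fun hA => ?_⟩
  · rintro ⟨q, hq, rfl⟩
    exact (mem_oppBorel_iff t hφ).1 hq
  · obtain ⟨q, rfl⟩ := φ.surjective A
    exact ⟨q, (mem_oppBorel_iff t hφ).2 hA, rfl⟩

/-- The coordinates ignore the nilradicals, so no Levi decomposition of `x` or `n x` has to be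
chosen. -/
theorem mem_image_iff (t : IsRootTriple i h e f) (hφ : IsCompatible h e f φ)
    {b : (rootSystem H).Base} (hi : i ∈ b.support) (n : 𝔤 ≃ₗ[ℂ] 𝔤)
    {p q : LeviQuot i} :
    (p, q) ∈ image b i n ↔ ∃ x ∈ parabolic b i, n x ∈ oppParabolic b i ∧
      slCoord h e f x = φ p ∧ slCoord h e f (n x) = φ q := by
  constructor
  · rintro ⟨⟨x₀, y₀⟩, hxy, hpq⟩
    obtain ⟨rfl, rfl⟩ : leviMk i x₀ = p ∧ leviMk i y₀ = q := Prod.mk.inj hpq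
    obtain ⟨⟨x, y⟩, ⟨⟨x', hx'⟩, hx, hy⟩, ⟨u, v⟩, ⟨hu, hv⟩, hsum⟩ := Submodule.mem_sup.1
      (show ((x₀ : 𝔤), (y₀ : 𝔤)) ∈ intersection b i n ⊔ (nilrad b i).prod (oppNilrad b i) from hxy)
    obtain ⟨rfl, rfl⟩ : x' = x ∧ n x' = y := Prod.mk.inj hx'
    obtain ⟨h₁, h₂⟩ : x' + u = x₀ ∧ n x' + v = y₀ := Prod.mk.inj hsum
    refine ⟨x', hx, hy, ?_, ?_⟩
    · rw [hφ, ← h₁, map_add, t.slCoord_nilrad hi hu, add_zero]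
    · rw [hφ, ← h₂, map_add, t.slCoord_oppNilrad hi hv, add_zero]
  · rintro ⟨x, hx, hnx, hp, hq⟩
    obtain ⟨x₀, hx₀, u, hu, hxu⟩ := Submodule.mem_sup.1 (parabolic_le_levi_sup_nilrad hx)
    obtain ⟨y₀, hy₀, v, hv, hyv⟩ := Submodule.mem_sup.1 (oppParabolic_le_levi_sup_oppNilrad hnx)
    refine ⟨(⟨x₀, hx₀⟩, ⟨y₀, hy₀⟩), ?_, ?_⟩
    · change (x₀, y₀) ∈ intersection b i n ⊔ (nilrad b i).prod (oppNilrad b i)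
      refine Submodule.mem_sup.2 ⟨(x, n x), ⟨⟨x, rfl⟩, hx, hnx⟩, (-u, -v),
        ⟨neg_mem hu, neg_mem hv⟩, ?_⟩
      rw [Prod.mk_add_mk, ← hyv, ← hxu, add_neg_cancel_right, add_neg_cancel_right]
    · refine Prod.ext (φ.injective ?_) (φ.injective ?_)
      · change φ (leviMk i ⟨x₀, hx₀⟩) = φ p
        rw [hφ, ← hp, ← hxu, map_add, t.slCoord_nilrad hi hu, add_zero]
      · change φ (leviMk i ⟨y₀, hy₀⟩) = φ q
        rw [hφ, ← hq, ← hyv, map_add, t.slCoord_oppNilrad hi hv, add_zero]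

end Compatible

theorem mem_diagonal_iff {V : Type*} [AddCommGroup V] [Module ℂ V] {p q : V} :
    (p, q) ∈ diagonal V ↔ p = q := by
  constructor
  · rintro ⟨x, hx⟩
    obtain ⟨rfl, rfl⟩ : x = p ∧ x = q := Prod.mk.inj hx
    rfl
  · rintro rfl
    exact ⟨p, rfl⟩

/-! ### The case `w α_i = α_i` -/

section Fixed

variable {b : (rootSystem H).Base} {i : H.root} {w : (rootSystem H).weylGroup}
  {n : 𝔤 ≃ₗ[ℂ] 𝔤}

theorem IsLift.apply_mem_levi (hn : IsLift w n) (hwi : w • i = i) {x : 𝔤} (hx : x ∈ levi i) :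
    n x ∈ levi i := by
  suffices (levi i).toSubmodule ≤ (levi i).toSubmodule.comap (n : 𝔤 →ₗ[ℂ] 𝔤) from this hx
  refine sup_le (sup_le (fun y hy => ?_) fun y hy => ?_) fun y hy => ?_
  · obtain ⟨k, hk, -⟩ := hn.2 ⟨y, hy⟩
    exact cartan_le_levi i (show n y ∈ H from hk ▸ k.2)
  · have := hn.apply_mem_rootSub hy
    rw [hwi] at this
    exact rootSub_le_levi i this
  · have := hn.apply_mem_negRootSub hy
    rw [hwi] at this
    exact negRootSub_le_levi i this

/-- Fixing `e` forces `n` to fix the whole triple, and `n` preserves the Killing form. The equality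
holds on all of `𝔤`, so `x` need not lie in the Levi subalgebra. -/
theorem IsLift.slCoord_apply {h e f : 𝔤} (t : IsRootTriple i h e f) (hn : IsLift w n)
    (hwi : w • i = i) (hne : n e = e) (x : 𝔤) : slCoord h e f (n x) = slCoord h e f x := by
  have hnf : n f ∈ negRootSub i := by
    have := hn.apply_mem_negRootSub (α := i) t.f_mem
    rwa [hwi] at this
  obtain ⟨d, hd⟩ := t.exists_eq_smul_f hnf
  have hnh : n h = d • h := by
    rw [← t.triple.lie_e_f, map_lie_of_mem_adjointGroup hn.1, hne, hd, lie_smul]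
  -- Evaluate `w α_i = α_i` at `n h = d h`: this gives `2d = 2`.
  have hd1 : d = 1 := by
    have h2 := hn.smul_root_apply i (k := coroot i.1) (k' := d • coroot i.1)
      (by rw [← t.h_eq_coroot, hnh, t.h_eq_coroot]; rfl)
    rw [hwi, IsRootTriple.root_h, ← LieModule.Weight.toLinear_apply, map_smul,
      LieModule.Weight.toLinear_apply, IsRootTriple.root_h, smul_eq_mul] at h2
    exact mul_right_cancel₀ two_ne_zero (h2.trans (one_mul 2).symm)
  rw [hd1, one_smul] at hd hnh
  have key (y : 𝔤) (hy : n y = y) : killingForm ℂ 𝔤 (n x) y = killingForm ℂ 𝔤 x y := by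
    conv_lhs => rw [← hy]
    exact killingForm_map_map_of_mem_adjointGroup hn.1 x y
  rw [DiagOrbit.slCoord_apply, DiagOrbit.slCoord_apply, key h hnh, key e hne, key f hd]

theorem image_eq_diagonal_iff (hi : i ∈ b.support) (hn : IsLift w n) (hwi : w • i = i) :
    image b i n = diagonal (LeviQuot i) ↔ ∀ x ∈ rootSub i, n x = x := by
  obtain ⟨h, e, f, t⟩ := exists_isRootTriple i
  obtain ⟨φ, hφ⟩ := t.exists_lieEquiv
  constructor
  · intro hd x hx
    have hnx : n x ∈ rootSub i := by
      have := hn.apply_mem_rootSub hx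
      rwa [hwi] at this
    obtain ⟨p, hp⟩ := φ.surjective (slCoord h e f x)
    obtain ⟨q, hq⟩ := φ.surjective (slCoord h e f (n x))
    have hmem : (p, q) ∈ image b i n := (mem_image_iff t hφ hi n).2
      ⟨x, levi_le_parabolic hi (rootSub_le_levi i hx),
        levi_le_oppParabolic hi (rootSub_le_levi i hnx), hp.symm, hq.symm⟩
    rw [hd, mem_diagonal_iff] at hmem
    rw [hmem, hq] at hp
    obtain ⟨a, ha⟩ := t.exists_eq_smul_e hx
    obtain ⟨c, hc⟩ := t.exists_eq_smul_e hnx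
    rw [hc, ha, map_smul, map_smul, t.slCoord_e, smul_slMk, smul_slMk, slMk_inj] at hp
    have hca : c = a := by simpa using hp.2.1
    rw [hc, hca, ha]
  · intro hfix
    have hcoord := hn.slCoord_apply t hwi (hfix e t.e_mem)
    ext ⟨p, q⟩
    rw [mem_image_iff t hφ hi n, mem_diagonal_iff]
    constructor
    · rintro ⟨x, -, -, hp, hq⟩
      exact φ.injective (hp.symm.trans ((hcoord x).symm.trans hq))
    · rintro rfl
      obtain ⟨a, b', c, hA⟩ := exists_eq_slMk (φ p)
      obtain ⟨hm, hc⟩ := t.slCoord_surjective_levi a b' c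
      exact ⟨_, levi_le_parabolic hi hm, levi_le_oppParabolic hi (hn.apply_mem_levi hwi hm),
        hc.trans hA.symm, (hcoord _).trans (hc.trans hA.symm)⟩

theorem exists_mem_torus_image_eq_diagonal (hi : i ∈ b.support) (hn : IsLift w n)
    (hwi : w • i = i) :
    ∃ s ∈ torus H, IsLift w (s * n) ∧ image b i (s * n) = diagonal (LeviQuot i) := by
  obtain ⟨h, e, f, t⟩ := exists_isRootTriple i
  have hne : n e ∈ rootSub i := by
    have := hn.apply_mem_rootSub (α := i) t.e_mem
    rwa [hwi] at this
  obtain ⟨c, hc⟩ := t.exists_eq_smul_e hne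
  have hc0 : c ≠ 0 := by
    rintro rfl
    rw [zero_smul] at hc
    exact t.triple.e_ne_zero ((map_eq_zero_iff n n.injective).1 hc)
  obtain ⟨s, hs, hse⟩ := t.exists_mem_torus (inv_ne_zero hc0)
  have hsn : IsLift w (s * n) := by
    have := (isLift_one_of_mem_torus hs).mul hn
    rwa [one_mul] at this
  refine ⟨s, hs, hsn, (image_eq_diagonal_iff hi hsn hwi).2 fun x hx => ?_⟩
  obtain ⟨a, rfl⟩ := t.exists_eq_smul_e hx
  rw [LinearEquiv.mul_apply, map_smul, map_smul, hc, map_smul, hse, smul_smul c,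
    mul_inv_cancel₀ hc0, one_smul]

end Fixed

/-! ### The case `w α_i ≠ α_i` -/

theorem exists_apply_eq_and_apply_eq {b : (rootSystem H).Base} {i j : H.root} (hi : b.IsPos i)
    (hj : b.IsPos j) (hij : i ≠ j) (r s : ℂ) : ∃ k : H, i.1 k = r ∧ j.1 k = s := by
  have hneg : (rootSystem H).root i ≠ -(rootSystem H).root j := fun h =>
    root_add_root_ne_zero hi hj (funext fun k => by
      simpa [eq_neg_iff_add_eq_zero] using LinearMap.congr_fun h k)
  have hdet : i.1 (coroot j.1) * j.1 (coroot i.1) ≠ 4 :=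
    (rootSystem H).linearIndependent_iff_coxeterWeight_ne_four.1
      (IsReduced.linearIndependent (rootSystem H) hij hneg)
  have hii := IsRootTriple.root_h (i := i)
  have hjj := IsRootTriple.root_h (i := j)
  set p := i.1 (coroot j.1) with hp
  set q := j.1 (coroot i.1) with hq
  have hdet' : 4 - p * q ≠ 0 := sub_ne_zero.2 hdet.symm
  -- Cramer's rule in the span of the two coroots; the determinant `4 - pq` is nonzero because
  -- distinct positive roots are independent.
  refine ⟨((4 - p * q)⁻¹ * (2 * r - p * s)) • coroot i.1 +
    ((4 - p * q)⁻¹ * (2 * s - q * r)) • coroot j.1, ?_, ?_⟩ <;>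
  · simp only [← LieModule.Weight.toLinear_apply, map_add, map_smul, smul_eq_mul]
    simp only [LieModule.Weight.toLinear_apply, hii, hjj, ← hp, ← hq]
    field_simp
    ring

theorem image_eq_prod {b : (rootSystem H).Base} {i : H.root} {w : (rootSystem H).weylGroup}
    {n : 𝔤 ≃ₗ[ℂ] 𝔤} (hi : i ∈ b.support) (hn : IsLift w n) (hwi : w • i ≠ i)
    (hpos : b.IsPos (w • i)) (hpos' : b.IsPos (w⁻¹ • i)) :
    image b i n = (oppBorel i).prod (borel i) := by
  obtain ⟨h, e, f, t⟩ := exists_isRootTriple i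
  obtain ⟨φ, hφ⟩ := t.exists_lieEquiv
  have hwi' : w⁻¹ • i ≠ i := fun h => hwi (by rw [← h, smul_inv_smul, h])
  have hninv : n (n⁻¹ e) = e := by rw [← LinearEquiv.mul_apply, mul_inv_cancel]; rfl
  have hne : n⁻¹ e ∈ rootSub (w⁻¹ • i) := hn.inv.apply_mem_rootSub t.e_mem
  have hnf : n f ∈ negRootSub (w • i) := hn.apply_mem_negRootSub t.f_mem
  refine le_antisymm ?_ ?_
  · rintro ⟨p, q⟩ hpq
    obtain ⟨x, hx, hnx, hp, hq⟩ := (mem_image_iff t hφ hi n).1 hpq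
    refine ⟨(mem_oppBorel_iff t hφ).2 ?_, (mem_borel_iff t hφ).2 ?_⟩
    · rw [← hp, slCoord_apply, slMk_mem_lowerSl2,
        ← killingForm_map_map_of_mem_adjointGroup hn.1 x f,
        killingForm_oppParabolic_eq_zero hpos hwi hnx hnf, mul_zero]
    · have := killingForm_map_map_of_mem_adjointGroup hn.1 x (n⁻¹ e)
      rw [hninv] at this
      rw [← hq, slCoord_apply, slMk_mem_upperSl2, this,
        killingForm_parabolic_eq_zero hpos' hwi' hx hne, mul_zero]
  · rintro ⟨p, q⟩ ⟨hp, hq⟩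
    obtain ⟨a, b₁, c, hA⟩ := exists_eq_slMk (φ p)
    obtain ⟨a', b₂, c', hB⟩ := exists_eq_slMk (φ q)
    have hp' := (mem_oppBorel_iff t hφ).1 hp
    have hq' := (mem_borel_iff t hφ).1 hq
    rw [hA, slMk_mem_lowerSl2] at hp'
    rw [hB, slMk_mem_upperSl2] at hq'
    subst hp' hq'
    -- The diagonal entries of `k` and `n k` are half of `α_i(k)` and of `α_i(n k) = (w⁻¹ α_i)(k)`.
    obtain ⟨k, hk₁, hk₂⟩ : ∃ k : H, i.1 k = 2 * a ∧ (w⁻¹ • i).1 k = 2 * a' :=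
      exists_apply_eq_and_apply_eq (Base.isPos_of_mem_support hi) hpos' hwi'.symm _ _
    obtain ⟨k', hk', -⟩ := hn.2 k
    have hk'₂ : i.1 k' = 2 * a' := by
      have := hn.smul_root_apply (w⁻¹ • i) hk'
      rwa [smul_inv_smul, hk₂] at this
    -- Each nilpotent term is seen on one side only: `n⁻¹ e` lies in `𝔲_i`, and `n f` lies in
    -- `𝔲_i⁻`.
    refine (mem_image_iff t hφ hi n).2 ⟨k + c • f + b₂ • n⁻¹ e, ?_, ?_, ?_, ?_⟩
    · refine add_mem (add_mem (cartan_le_parabolic k.2) ?_) ?_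
      · exact levi_le_parabolic hi (negRootSub_le_levi i (Submodule.smul_mem _ c t.f_mem))
      · exact Submodule.smul_mem _ _ (rootSub_le_parabolic hpos' hne)
    · rw [map_add, map_add, map_smul, map_smul, hninv, hk']
      refine add_mem (add_mem (cartan_le_oppParabolic k'.2) ?_) ?_
      · exact Submodule.smul_mem _ _ (negRootSub_le_oppParabolic hpos hnf)
      · exact levi_le_oppParabolic hi (rootSub_le_levi i (Submodule.smul_mem _ _ t.e_mem))
    · have hu : slCoord h e f (n⁻¹ e) = 0 := t.slCoord_nilrad hi
        (Submodule.mem_iSup_of_mem _ (Submodule.mem_iSup_of_mem ⟨hpos', hwi'⟩ hne))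
      rw [map_add, map_smul, hu, smul_zero, add_zero, hA]
      have := t.slCoord_add_add k 0 c
      rw [zero_smul, add_zero] at this
      rw [this, hk₁, slMk_inj]
      exact ⟨by ring, rfl, rfl⟩
    · have hv : slCoord h e f (n f) = 0 := t.slCoord_oppNilrad hi
        (Submodule.mem_iSup_of_mem _ (Submodule.mem_iSup_of_mem ⟨hpos, hwi⟩ hnf))
      have := t.slCoord_add_add k' b₂ 0
      rw [zero_smul, add_zero] at this
      rw [add_right_comm, map_add n, map_add n, map_smul n, map_smul n, hninv, hk', map_add, this,
        map_smul, hv, smul_zero, add_zero, hB, hk'₂, slMk_inj]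
      exact ⟨by ring, rfl, rfl⟩

end DiagOrbit

end

theorem mainTheorem4 {𝔤 : Type*} [LieRing 𝔤] [LieAlgebra ℂ 𝔤] [FiniteDimensional ℂ 𝔤]
    [LieAlgebra.IsSemisimple ℂ 𝔤] (H : LieSubalgebra ℂ 𝔤) [H.IsCartanSubalgebra]
    (b : (LieAlgebra.IsKilling.rootSystem H).Base) (i : H.root) (hi : i ∈ b.support)
    (w : (LieAlgebra.IsKilling.rootSystem H).weylGroup) (hw : DiagOrbit.IsMinimalRep b i w) :
    (∃ φ : DiagOrbit.LeviQuot i ≃ₗ⁅ℂ⁆ LieAlgebra.SpecialLinear.sl (Fin 2) ℂ,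
      (DiagOrbit.borel i).map (φ : DiagOrbit.LeviQuot i →ₗ[ℂ] _) = DiagOrbit.upperSl2 ∧
      (DiagOrbit.oppBorel i).map (φ : DiagOrbit.LeviQuot i →ₗ[ℂ] _) = DiagOrbit.lowerSl2) ∧
    (∃ n, DiagOrbit.IsLift w n) ∧
    ∀ n, DiagOrbit.IsLift w n →
      (w • i = i →
        (DiagOrbit.image b i n = DiagOrbit.diagonal (DiagOrbit.LeviQuot i) ↔
          ∀ x ∈ DiagOrbit.rootSub i, n x = x) ∧
        ∃ t ∈ DiagOrbit.torus H, DiagOrbit.IsLift w (t * n) ∧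
          DiagOrbit.image b i (t * n) = DiagOrbit.diagonal (DiagOrbit.LeviQuot i)) ∧
      (w • i ≠ i →
        DiagOrbit.image b i n = (DiagOrbit.oppBorel i).prod (DiagOrbit.borel i)) := by
  obtain ⟨h, e, f, t⟩ := DiagOrbit.exists_isRootTriple i
  obtain ⟨φ, hφ⟩ := t.exists_lieEquiv
  refine ⟨⟨φ, DiagOrbit.map_borel t hφ, DiagOrbit.map_oppBorel t hφ⟩, DiagOrbit.exists_isLift w,
    fun n hn => ⟨fun hwi => ⟨DiagOrbit.image_eq_diagonal_iff hi hn hwi,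
      DiagOrbit.exists_mem_torus_image_eq_diagonal hi hn hwi⟩, fun hwi => ?_⟩⟩
  exact DiagOrbit.image_eq_prod hi hn hwi (hw.isPos_smul hi) (hw.isPos_inv_smul hi)
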